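/- Consider a 3-user discrete memoryless interference channel: finite input alphabets $\mathcal X_1,\mathcal X_2,\mathcal X_3$, finite output alphabets $\mathcal Y_1,\mathcal Y_2,\mathcal Y_3$ and a transition probability $p(y_1,y_2,y_3\mid x_1,x_2,x_3)$, used without memory. For $i\in\{1,2,3\}$, user $i$ encodes a message $W_i$ into a codeword $X_i^n$ and receiver $i$ estimates $W_i$ from $Y_i^n$; the messages are independent and $W_i$ is uniform on a set of $\lceil 2^{nR_i}\rceil$ elements. A triple $(R_1,R_2,R_3)$ of nonnegative reals is achievable if there is a sequence of such codes, one for each block length $n$, whose average error probability $P\{(W_1',W_2',W_3')\ne(W_1,W_2,W_3)\}$ tends to $0$, and the capacity region is the closure of the set of achievable triples. Mutual informations are in bits. Suppose that for all product input distributions $p_{X_1}(x_1)p_{X_2}(x_2)p_{X_3}(x_3)$ $$I[X_1;Y_2]\ge I[X_1;Y_1|X_2,X_3],\quad I[X_2;Y_3]\ge I[X_2;Y_2|X_3,X_1],\quad I[X_3;Y_1]\ge I[X_3;Y_3|X_1,X_2],$$ $$I[X_1;Y_1|X_2,X_3]\le I[X_1;Y_3|X_2,X_3],\quad I[X_2;Y_2|X_3,X_1]\le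 I[X_2;Y_1|X_3,X_1],\quad I[X_3;Y_3|X_1,X_2]\le I[X_3;Y_2|X_1,X_2].$$ Then the capacity region is exactly the set of all triples $(R_1,R_2,R_3)$ of nonnegative reals for which there are a random variable $Q$ with at most $7$ values and a joint distribution $p_Q(q)\,p_{X_1|Q}(x_1|q)\,p_{X_2|Q}(x_2|q)\,p_{X_3|Q}(x_3|q)$, with $(Y_1,Y_2,Y_3)$ the channel output for the input $(X_1,X_2,X_3)$, such that $$R_1\le I[X_1;Y_1|X_2,X_3,Q],\quad R_2\le I[X_2;Y_2|X_3,X_1,Q],\quad R_3\le I[X_3;Y_3|X_1,X_2,Q],$$ $$R_1+R_2\le I[X_1,X_2;Y_1|X_3,Q],\quad R_2+R_3\le I[X_2,X_3;Y_2|X_1,Q],\quad R_3+R_1\le I[X_3,X_1;Y_3|X_2,Q].$$ -/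

import Mathlib

open scoped BigOperators Topology

/- Information quantities of discrete random variables. The sample space `Ω` is finite with
probability mass function `μ : Ω → ℝ`; random variables are maps on `Ω`; logarithms are to
base 2. -/
namespace InfoTheory

variable {Ω α β γ : Type*} [Fintype Ω] [Fintype α] [Fintype β] [Fintype γ]

open Classical in
/-- `ℙ (A = a)` under the mass function `μ`. -/
noncomputable def law {α : Type*} (μ : Ω → ℝ) (A : Ω → α) (a : α) : ℝ :=
  ∑ ω, if A ω = a then μ ω else 0

/-- The mutual information `I[A;B] = ∑ p(a,b) log₂ (p(a,b) / (p(a) p(b)))`. A term with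
`p(a,b) = 0` vanishes, as usual. -/
noncomputable def mutualInfo (μ : Ω → ℝ) (A : Ω → α) (B : Ω → β) : ℝ :=
  ∑ a, ∑ b, law μ (fun ω => (A ω, B ω)) (a, b) *
    Real.logb 2 (law μ (fun ω => (A ω, B ω)) (a, b) / (law μ A a * law μ B b))

/-- The conditional mutual information
`I[A;B|C] = ∑ p(a,b,c) log₂ (p(a,b,c) p(c) / (p(a,c) p(b,c)))`. -/
noncomputable def condMutualInfo (μ : Ω → ℝ) (A : Ω → α) (B : Ω → β) (C : Ω → γ) : ℝ :=
  ∑ a, ∑ b, ∑ c, law μ (fun ω => (A ω, B ω, C ω)) (a, b, c) *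
    Real.logb 2 (law μ (fun ω => (A ω, B ω, C ω)) (a, b, c) * law μ C c /
      (law μ (fun ω => (A ω, C ω)) (a, c) * law μ (fun ω => (B ω, C ω)) (b, c)))

end InfoTheory

open InfoTheory

/-- A 3-user discrete memoryless interference channel with input alphabets `X i` and output
alphabets `Y i`, given by its transition probability `p(y₁,y₂,y₃ | x₁,x₂,x₃)`. Users are
indexed by `Fin 3`, so that `i + 1` and `i + 2` are the two other users, cyclically. -/
structure DMIC (X Y : Fin 3 → Type*) [∀ i, Fintype (X i)] [∀ i, Fintype (Y i)] where
  /-- `trans x y = p(y | x)` -/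
  trans : (∀ i, X i) → (∀ i, Y i) → ℝ
  trans_mem : ∀ x, trans x ∈ stdSimplex ℝ (∀ i, Y i)

/-- A code of block length `n` with `M i` messages for user `i`: user `i` encodes its own
message, and receiver `i` estimates the message of user `i` from its own output sequence. -/
structure DMICCode (X Y : Fin 3 → Type*) (n : ℕ) (M : Fin 3 → ℕ) where
  enc : ∀ i, Fin (M i) → Fin n → X i
  dec : ∀ i, (Fin n → Y i) → Fin (M i)

namespace DMIC

variable {X Y : Fin 3 → Type*} [∀ i, Fintype (X i)] [∀ i, Fintype (Y i)]

/-- The average probability that some receiver errs, for independent and uniformly distributed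
messages and `n` memoryless uses of the channel. -/
noncomputable def errorProb (W : DMIC X Y) {n : ℕ} {M : Fin 3 → ℕ} (c : DMICCode X Y n M) : ℝ :=
  (∏ i, (M i : ℝ))⁻¹ * ∑ w : (∀ i, Fin (M i)), ∑ y : Fin n → (∀ i, Y i),
    if ∃ i, c.dec i (fun t => y t i) ≠ w i then
      ∏ t, W.trans (fun i => c.enc i (w i) t) (y t)
    else 0

/-- The rate triple `R` is achievable: there are codes of all block lengths `n` with `2 ^ (n R i)`
messages (rounded up to an integer) for user `i` whose average error probability tends to `0`. -/
def Achievable (W : DMIC X Y) (R : Fin 3 → ℝ) : Prop :=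
  (∀ i, 0 ≤ R i) ∧
    ∃ c : ∀ n : ℕ, DMICCode X Y n (fun i => ⌈(2 : ℝ) ^ ((n : ℝ) * R i)⌉₊),
      Filter.Tendsto (fun n => W.errorProb (c n)) Filter.atTop (𝓝 0)

/-- The capacity region: the closure of the set of achievable rate triples. -/
def capacityRegion (W : DMIC X Y) : Set (Fin 3 → ℝ) :=
  closure {R | W.Achievable R}

/-- The joint law of inputs and outputs under the product input distribution
`p₁(x₁) p₂(x₂) p₃(x₃)`. -/
def jointLaw (W : DMIC X Y) (p : ∀ i, X i → ℝ) : (∀ i, X i) × (∀ i, Y i) → ℝ :=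
  fun z => (∏ i, p i (z.1 i)) * W.trans z.1 z.2

/-- The joint law of `(Q, X, Y)` under `p_Q(q) p₁(x₁|q) p₂(x₂|q) p₃(x₃|q)`; here
`p i q` is the conditional distribution of the `i`-th input given `Q = q`. -/
def timeSharingLaw {Q : Type*} (W : DMIC X Y) (pQ : Q → ℝ) (p : ∀ i, Q → X i → ℝ) :
    Q × (∀ i, X i) × (∀ i, Y i) → ℝ :=
  fun z => pQ z.1 * (∏ i, p i z.1 (z.2.1 i)) * W.trans z.2.1 z.2.2

/-- Very strong interference of user `i` at receiver `i + 1`, for every `i`: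
`I[Xᵢ;Yᵢ₊₁] ≥ I[Xᵢ;Yᵢ|Xᵢ₊₁,Xᵢ₊₂]` for all product input distributions. -/
def CyclicVeryStrong (W : DMIC X Y) : Prop :=
  ∀ p : ∀ i, X i → ℝ, (∀ i, p i ∈ stdSimplex ℝ (X i)) → ∀ i : Fin 3,
    condMutualInfo (W.jointLaw p) (fun z => z.1 i) (fun z => z.2 i)
        (fun z => (z.1 (i + 1), z.1 (i + 2)))
      ≤ mutualInfo (W.jointLaw p) (fun z => z.1 i) (fun z => z.2 (i + 1))

/-- Strong interference of user `i` at receiver `i + 2`, for every `i`: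
`I[Xᵢ;Yᵢ|Xᵢ₊₁,Xᵢ₊₂] ≤ I[Xᵢ;Yᵢ₊₂|Xᵢ₊₁,Xᵢ₊₂]` for all product input distributions. -/
def CyclicStrong (W : DMIC X Y) : Prop :=
  ∀ p : ∀ i, X i → ℝ, (∀ i, p i ∈ stdSimplex ℝ (X i)) → ∀ i : Fin 3,
    condMutualInfo (W.jointLaw p) (fun z => z.1 i) (fun z => z.2 i)
        (fun z => (z.1 (i + 1), z.1 (i + 2)))
      ≤ condMutualInfo (W.jointLaw p) (fun z => z.1 i) (fun z => z.2 (i + 2))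
        (fun z => (z.1 (i + 1), z.1 (i + 2)))

/-- The rate constraints for a law `μ` of `(Q, X, Y)`: for every `i`,
`0 ≤ Rᵢ ≤ I[Xᵢ;Yᵢ|Xᵢ₊₁,Xᵢ₊₂,Q]` and `Rᵢ + Rᵢ₊₁ ≤ I[Xᵢ,Xᵢ₊₁;Yᵢ|Xᵢ₊₂,Q]`. -/
def RateBounds {Q : Type*} [Fintype Q] (μ : Q × (∀ i, X i) × (∀ i, Y i) → ℝ)
    (R : Fin 3 → ℝ) : Prop :=
  ∀ i : Fin 3, 0 ≤ R i ∧
    R i ≤ condMutualInfo μ (fun z => z.2.1 i) (fun z => z.2.2 i)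
      (fun z => (z.2.1 (i + 1), z.2.1 (i + 2), z.1)) ∧
    R i + R (i + 1) ≤ condMutualInfo μ (fun z => (z.2.1 i, z.2.1 (i + 1))) (fun z => z.2.2 i)
      (fun z => (z.2.1 (i + 2), z.1))

end DMIC

/-! Indices are cyclic. For the direct part, receiver `i` decodes `W (i + 2)` from its output alone,
treating the other two inputs as noise. Very strong interference of user `i + 2` at receiver `i`
makes this no costlier than the bound that `R (i + 2)` obeys anyway. With `X (i + 2)` known, what
remains is a two-user multiple access channel in which only `W i` must be correct. An error in `W (i
+ 1)` alone is harmless, so only `R i` and `R i + R (i + 1)` are constrained, and these constraints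
are those of the region. Typicality is replaced by three likelihood-ratio tests: a wrong message
passes with probability at most the inverse threshold (`sum_codebookWeight_mul_pass_le`), and the
true one fails with exponentially small probability (`exists_lower_tail_le`,
`exists_fail_tests_le`). `exists_code` then extracts one time-sharing sequence and one codebook.

The converse uses strong interference only. Fano's inequality with both other messages as a genie
bounds `R i`. For `R i + R (i + 1)`, message `i` gets the genie `W (i + 2)` and message `i + 1` gets
the genie `(W (i + 2), W i)`. Strong interference of user `i + 1` at receiver `i`, extended to
blocks by exchanging one letter at a time (`entropy_outputs_strong_le`), replaces the output at `i +
1` by the one at `i`, and the two bounds telescope.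

Conditioning on `Q` averages the six mutual informations, so the region is described by the lower
closure of the convex hull of a compact set in dimension six. Carathéodory's theorem gives the seven
values of `Q`, and compactness of the hull gives closedness, which absorbs the limit in the
converse. -/

namespace InfoTheory

/-! ### Entropy of finite random variables -/

section Entropy

variable {Ω α β γ δ : Type*} [Fintype Ω]

open Classical in
theorem law_nonneg {μ : Ω → ℝ} (hμ : ∀ ω, 0 ≤ μ ω) (A : Ω → α) (a : α) : 0 ≤ law μ A a :=
  Finset.sum_nonneg fun ω _ => by split_ifs <;> simp [hμ]

open Classical in
theorem le_law {μ : Ω → ℝ} (hμ : ∀ ω, 0 ≤ μ ω) (A : Ω → α) (ω : Ω) : μ ω ≤ law μ A (A ω) := by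
  have := Finset.single_le_sum (f := fun ω' => if A ω' = A ω then μ ω' else 0)
    (fun ω' _ => by split_ifs <;> simp [hμ]) (Finset.mem_univ ω)
  simpa [law] using this

theorem law_pos {μ : Ω → ℝ} (hμ : ∀ ω, 0 ≤ μ ω) (A : Ω → α) {ω : Ω} (h : μ ω ≠ 0) :
    0 < law μ A (A ω) :=
  lt_of_lt_of_le (lt_of_le_of_ne (hμ ω) h.symm) (le_law hμ A ω)

open Classical in
theorem sum_law_mul [Fintype α] (μ : Ω → ℝ) (A : Ω → α) (f : α → ℝ) :
    ∑ a, law μ A a * f a = ∑ ω, μ ω * f (A ω) := by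
  simp only [law, Finset.sum_mul, ite_mul, zero_mul]
  rw [Finset.sum_comm]
  simp

theorem sum_law [Fintype α] (μ : Ω → ℝ) (A : Ω → α) : ∑ a, law μ A a = ∑ ω, μ ω := by
  simpa using sum_law_mul μ A 1

theorem law_congr (μ : Ω → ℝ) {A : Ω → α} {B : Ω → β} {a : α} {b : β}
    (h : ∀ ω, A ω = a ↔ B ω = b) : law μ A a = law μ B b := by
  refine Finset.sum_congr rfl fun ω _ => ?_
  by_cases hb : B ω = b
  · simp [(h ω).2 hb, hb]
  · simp [mt (h ω).1 hb, hb]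

open Classical in
theorem law_law [Fintype α] (μ : Ω → ℝ) (Z : Ω → α) (A : α → β) (b : β) :
    law (law μ Z) A b = law μ (fun ω => A (Z ω)) b := by
  have := sum_law_mul μ Z (fun a => if A a = b then 1 else 0)
  simpa [law] using this

theorem law_comp_mono {μ : Ω → ℝ} (hμ : ∀ ω, 0 ≤ μ ω) {A : Ω → α} {B : Ω → β} {a : α} {b : β}
    (h : ∀ ω, A ω = a → B ω = b) : law μ A a ≤ law μ B b := by
  refine Finset.sum_le_sum fun ω _ => ?_
  by_cases h1 : A ω = a
  · simp [h1, h ω h1]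
  · simp only [h1, if_false]; split_ifs <;> simp [hμ]

/-- The Shannon entropy, in bits, of a random variable. -/
noncomputable def entropy (μ : Ω → ℝ) (A : Ω → α) : ℝ :=
  -∑ ω, μ ω * Real.logb 2 (law μ A (A ω))

/-- Entropy only depends on the partition that a random variable generates. -/
theorem entropy_congr (μ : Ω → ℝ) {A : Ω → α} {B : Ω → β}
    (h : ∀ ω ω', A ω = A ω' ↔ B ω = B ω') : entropy μ A = entropy μ B := by
  unfold entropy
  congr 1
  refine Finset.sum_congr rfl fun ω _ => ?_
  rw [law_congr μ fun ω' => h ω' ω]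

theorem entropy_law [Fintype α] (μ : Ω → ℝ) (Z : Ω → α) (A : α → β) :
    entropy (law μ Z) A = entropy μ (fun ω => A (Z ω)) := by
  unfold entropy
  rw [sum_law_mul μ Z (fun a => Real.logb 2 (law (law μ Z) A (A a)))]
  simp only [law_law]

/-- Used for continuity: `Real.negMulLog` is continuous even where a probability vanishes. -/
theorem entropy_eq_sum_negMulLog [Fintype α] (μ : Ω → ℝ) (A : Ω → α) :
    entropy μ A = (∑ a, Real.negMulLog (law μ A a)) / Real.log 2 := by
  unfold entropy
  rw [← sum_law_mul μ A (fun a => Real.logb 2 (law μ A a)), Finset.sum_div, ← Finset.sum_neg_distrib]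
  refine Finset.sum_congr rfl fun a _ => ?_
  simp only [Real.negMulLog, Real.logb]
  ring

theorem condMutualInfo_eq_sum [Fintype α] [Fintype β] [Fintype γ] (μ : Ω → ℝ) (A : Ω → α)
    (B : Ω → β) (C : Ω → γ) :
    condMutualInfo μ A B C = ∑ ω, μ ω * Real.logb 2
      (law μ (fun ω => (A ω, B ω, C ω)) (A ω, B ω, C ω) * law μ C (C ω) /
        (law μ (fun ω => (A ω, C ω)) (A ω, C ω) * law μ (fun ω => (B ω, C ω)) (B ω, C ω))) := by
  rw [← sum_law_mul μ (fun ω => (A ω, B ω, C ω)) (fun x => Real.logb 2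
      (law μ (fun ω => (A ω, B ω, C ω)) x * law μ C x.2.2 /
        (law μ (fun ω => (A ω, C ω)) (x.1, x.2.2) * law μ (fun ω => (B ω, C ω)) x.2)))]
  simp only [condMutualInfo, Fintype.sum_prod_type]

/-- Outcomes of mass zero contribute nothing, and on the others all four probabilities are positive,
so the logarithm splits. Later identities between informations thereby reduce to comparing
partitions through `entropy_congr`. -/
theorem condMutualInfo_eq_entropy [Fintype α] [Fintype β] [Fintype γ] {μ : Ω → ℝ}
    (hμ : ∀ ω, 0 ≤ μ ω) (A : Ω → α) (B : Ω → β) (C : Ω → γ) :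
    condMutualInfo μ A B C = entropy μ (fun ω => (A ω, C ω)) + entropy μ (fun ω => (B ω, C ω))
      - entropy μ (fun ω => (A ω, B ω, C ω)) - entropy μ C := by
  rw [condMutualInfo_eq_sum]
  simp only [entropy, ← Finset.sum_neg_distrib, ← Finset.sum_add_distrib, ← Finset.sum_sub_distrib]
  refine Finset.sum_congr rfl fun ω _ => ?_
  by_cases h : μ ω = 0
  · simp [h]
  have h1 := (law_pos hμ (fun ω => (A ω, B ω, C ω)) h).ne'
  have h2 := (law_pos hμ C h).ne'
  have h3 := (law_pos hμ (fun ω => (A ω, C ω)) h).ne'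
  have h4 := (law_pos hμ (fun ω => (B ω, C ω)) h).ne'
  rw [Real.logb_div (mul_ne_zero h1 h2) (mul_ne_zero h3 h4), Real.logb_mul h1 h2,
    Real.logb_mul h3 h4]
  ring

theorem entropy_const {μ : Ω → ℝ} (h1 : ∑ ω, μ ω = 1) (c : α) : entropy μ (fun _ => c) = 0 := by
  simp [entropy, law, h1]

theorem mutualInfo_eq_condMutualInfo [Fintype α] [Fintype β] {μ : Ω → ℝ}
    (h1 : ∑ ω, μ ω = 1) (A : Ω → α) (B : Ω → β) :
    mutualInfo μ A B = condMutualInfo μ A B (fun _ => ()) := by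
  have e1 : ∀ a b, law μ (fun ω => (A ω, B ω, ())) (a, b, ()) = law μ (fun ω => (A ω, B ω)) (a, b) :=
    fun a b => law_congr μ fun ω => by simp
  have e2 : ∀ a, law μ (fun ω => (A ω, ())) (a, ()) = law μ A a := fun a => law_congr μ fun ω => by simp
  have e3 : ∀ b, law μ (fun ω => (B ω, ())) (b, ()) = law μ B b := fun a => law_congr μ fun ω => by simp
  have e4 : law μ (fun _ => ()) () = 1 := by simp [law, h1]
  simp [mutualInfo, condMutualInfo, e1, e2, e3, e4]

theorem logb_sub_logb_le {x y : ℝ} (hx : 0 < x) (hy : 0 < y) :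
    Real.logb 2 x - Real.logb 2 y ≤ (x / y - 1) / Real.log 2 := by
  rw [← Real.logb_div hx.ne' hy.ne', Real.logb]
  have h2 : 0 < Real.log 2 := Real.log_pos (by norm_num)
  gcongr
  exact Real.log_le_sub_one_of_pos (div_pos hx hy)

/-- Gibbs' inequality for conditional entropy: coding `A` given `B` with the conditional
subprobability `r` costs at least the conditional entropy. -/
theorem entropy_pair_sub_le [Fintype α] [Fintype β] {μ : Ω → ℝ} (hμ : ∀ ω, 0 ≤ μ ω)
    (A : Ω → α) (B : Ω → β) (r : α → β → ℝ) (hr : ∀ a b, 0 ≤ r a b)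
    (hr1 : ∀ b, ∑ a, r a b ≤ 1) (hpos : ∀ ω, μ ω ≠ 0 → 0 < r (A ω) (B ω)) :
    entropy μ (fun ω => (A ω, B ω)) - entropy μ B ≤ -∑ ω, μ ω * Real.logb 2 (r (A ω) (B ω)) := by
  have h2 : 0 < Real.log 2 := Real.log_pos (by norm_num)
  set P : α × β → ℝ := law μ (fun ω => (A ω, B ω)) with hP
  -- The bound `log x ≤ x - 1` at the ratio of the subprobability `p(b) r(a,b)` to the true
  -- `p(a,b)`.
  have key : ∀ ω, μ ω * (Real.logb 2 (law μ B (B ω)) + Real.logb 2 (r (A ω) (B ω))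
      - Real.logb 2 (P (A ω, B ω))) ≤
      (μ ω * (law μ B (B ω) * r (A ω) (B ω) / P (A ω, B ω)) - μ ω) / Real.log 2 := by
    intro ω
    by_cases h : μ ω = 0
    · simp [h]
    have hB := law_pos hμ B h
    have hA : 0 < P (A ω, B ω) := law_pos hμ (fun ω => (A ω, B ω)) h
    have hrr := hpos ω h
    rw [← Real.logb_mul hB.ne' hrr.ne']
    have := mul_le_mul_of_nonneg_left (logb_sub_logb_le (mul_pos hB hrr) hA) (hμ ω)
    refine this.trans (le_of_eq ?_)
    ring
  have hsum : ∑ ω, μ ω * (law μ B (B ω) * r (A ω) (B ω) / P (A ω, B ω)) ≤ ∑ ω, μ ω := by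
    rw [← sum_law_mul μ (fun ω => (A ω, B ω)) (fun x => law μ B x.2 * r x.1 x.2 / P x),
      Fintype.sum_prod_type_right, ← sum_law μ B]
    refine Finset.sum_le_sum fun b _ => ?_
    calc ∑ a, P (a, b) * (law μ B b * r a b / P (a, b)) ≤ ∑ a, law μ B b * r a b := by
          refine Finset.sum_le_sum fun a _ => ?_
          by_cases h : P (a, b) = 0
          · simp only [h, zero_mul]
            exact mul_nonneg (law_nonneg hμ B b) (hr a b)
          · rw [mul_div_cancel₀ _ h]
      _ ≤ law μ B b := by
          rw [← Finset.mul_sum]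
          exact mul_le_of_le_one_right (law_nonneg hμ B b) (hr1 b)
  have := Finset.sum_le_sum fun ω (_ : ω ∈ Finset.univ) => key ω
  rw [← Finset.sum_div, Finset.sum_sub_distrib] at this
  have h0 : (∑ ω, μ ω * (law μ B (B ω) * r (A ω) (B ω) / P (A ω, B ω)) - ∑ ω, μ ω) / Real.log 2
      ≤ 0 := div_nonpos_of_nonpos_of_nonneg (by linarith) h2.le
  have h3 := this.trans h0
  simp only [mul_sub, mul_add, Finset.sum_sub_distrib, Finset.sum_add_distrib] at h3
  simp only [entropy]
  linarith

/-- Submodularity of entropy: conditional mutual information is nonnegative. -/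
theorem entropy_submodular [Fintype α] [Fintype β] [Fintype γ] {μ : Ω → ℝ} (hμ : ∀ ω, 0 ≤ μ ω)
    (A : Ω → α) (B : Ω → β) (C : Ω → γ) :
    entropy μ (fun ω => (A ω, B ω, C ω)) + entropy μ C
      ≤ entropy μ (fun ω => (A ω, C ω)) + entropy μ (fun ω => (B ω, C ω)) := by
  -- Code `A` given `(B, C)` with the conditional law of `A` given `C` alone.
  have := entropy_pair_sub_le hμ A (fun ω => (B ω, C ω))
    (fun a x => law μ (fun ω => (A ω, C ω)) (a, x.2) / law μ C x.2)
    (fun a x => div_nonneg (law_nonneg hμ _ _) (law_nonneg hμ _ _))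
    (fun x => by
      rw [← Finset.sum_div]
      have : ∑ a, law μ (fun ω => (A ω, C ω)) (a, x.2) = law μ C x.2 := by
        classical
        simp only [law, Prod.mk.injEq]
        rw [Finset.sum_comm]
        refine Finset.sum_congr rfl fun ω _ => ?_
        by_cases h : C ω = x.2 <;> simp [h]
      rw [this]
      -- Where `C` has probability zero the quotient is `0 / 0 = 0`, which is why Gibbs' inequality
      -- is stated for subprobabilities.
      exact div_self_le_one _)
    (fun ω h => div_pos (law_pos hμ (fun ω => (A ω, C ω)) h) (law_pos hμ C h))
  have e : ∑ ω, μ ω * Real.logb 2 (law μ (fun ω => (A ω, C ω)) (A ω, C ω) / law μ C (C ω))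
      = entropy μ C - entropy μ (fun ω => (A ω, C ω)) := by
    simp only [entropy, ← Finset.sum_neg_distrib, ← Finset.sum_sub_distrib]
    refine Finset.sum_congr rfl fun ω _ => ?_
    by_cases h : μ ω = 0
    · simp [h]
    rw [Real.logb_div (law_pos hμ (fun ω => (A ω, C ω)) h).ne' (law_pos hμ C h).ne']
    ring
  simp only at this
  rw [e] at this
  linarith

/-- Gibbs' inequality for the uniform code, with trivial conditioning. -/
theorem entropy_le_logb_card [Fintype α] {μ : Ω → ℝ} (hμ : ∀ ω, 0 ≤ μ ω) (h1 : ∑ ω, μ ω = 1)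
    (A : Ω → α) : entropy μ A ≤ Real.logb 2 (Fintype.card α) := by
  rcases isEmpty_or_nonempty α with hα | hα
  · have : IsEmpty Ω := ⟨fun ω => hα.elim (A ω)⟩
    simp at h1
  have hc : (0 : ℝ) < Fintype.card α := by exact_mod_cast Fintype.card_pos
  have := entropy_pair_sub_le hμ A (fun _ => ()) (fun _ _ => (Fintype.card α : ℝ)⁻¹)
    (fun _ _ => by positivity) (fun _ => by simp [hc.ne']) (fun _ _ => by positivity)
  rw [entropy_const h1, ← Finset.sum_mul, h1, Real.logb_inv] at this
  rw [entropy_congr μ (B := A) (by simp)] at this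
  linarith

end Entropy

end InfoTheory

/-! ### Carathéodory's theorem and compactness of convex hulls -/

/-- Carathéodory gives affinely independent points, hence at most `finrank + 1` of them. Padding
with zero weights makes the number of points the same for all `x`. -/
theorem exists_stdSimplex_of_mem_convexHull {E : Type*} [AddCommGroup E] [Module ℝ E]
    [FiniteDimensional ℝ E] {d : ℕ} (hd : Module.finrank ℝ E + 1 ≤ d) {s : Set E} {x : E}
    (hx : x ∈ convexHull ℝ s) :
    ∃ w ∈ stdSimplex ℝ (Fin d), ∃ z : Fin d → E, (∀ i, z i ∈ s) ∧ ∑ i, w i • z i = x := by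
  obtain ⟨ι, hι, z, w, hz, hind, hw, hw1, hx⟩ := eq_pos_convex_span_of_mem_convexHull hx
  have hcard : Fintype.card ι ≤ Fintype.card (Fin d) := by
    have h1 := hind.card_le_finrank_succ
    have h2 := Submodule.finrank_le (vectorSpan ℝ (Set.range z))
    rw [Fintype.card_fin]
    omega
  obtain ⟨e⟩ := Function.Embedding.nonempty_of_card_le hcard
  obtain ⟨i₀⟩ : Nonempty ι := by
    by_contra h
    rw [not_nonempty_iff] at h
    simp at hw1
  have hsum : ∀ i, Function.extend e w 0 (e i) = w i := fun i => e.injective.extend_apply _ _ _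
  have hzero : ∀ j ∉ Set.range e, Function.extend e w 0 j = 0 := fun j hj =>
    Function.extend_apply' _ _ _ (by simpa using hj)
  refine ⟨Function.extend e w 0, ⟨fun j => ?_, ?_⟩, Function.extend e z fun _ => z i₀, fun j => ?_, ?_⟩
  · by_cases hj : j ∈ Set.range e
    · obtain ⟨i, rfl⟩ := hj
      rw [hsum]
      exact (hw i).le
    · rw [hzero j hj]
  · rw [← hw1]
    exact (Fintype.sum_of_injective e e.injective _ _ hzero fun i => (hsum i).symm).symm
  · by_cases hj : j ∈ Set.range e
    · obtain ⟨i, rfl⟩ := hj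
      rw [e.injective.extend_apply]
      exact hz ⟨i, rfl⟩
    · rw [Function.extend_apply' _ _ _ (by simpa using hj)]
      exact hz ⟨i₀, rfl⟩
  · rw [← hx]
    refine (Fintype.sum_of_injective e e.injective _ _ (fun j hj => ?_) fun i => ?_).symm
    · rw [hzero j hj, zero_smul]
    · rw [hsum, e.injective.extend_apply]

/-- With a fixed number of points the hull is the continuous image of the compact set of weights and
points. -/
theorem IsCompact.convexHull_of_finiteDimensional {E : Type*} [AddCommGroup E] [Module ℝ E]
    [FiniteDimensional ℝ E] [TopologicalSpace E] [ContinuousAdd E] [ContinuousSMul ℝ E]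
    {s : Set E} (hs : IsCompact s) : IsCompact (convexHull ℝ s) := by
  set d := Module.finrank ℝ E + 1 with hd
  have hK : IsCompact (stdSimplex ℝ (Fin d) ×ˢ Set.univ.pi fun _ : Fin d => s) :=
    (isCompact_stdSimplex ℝ (Fin d)).prod (isCompact_univ_pi fun _ => hs)
  have hcont : Continuous fun x : (Fin d → ℝ) × (Fin d → E) => ∑ i, x.1 i • x.2 i := by
    fun_prop
  convert hK.image hcont
  ext x
  constructor
  · intro hx
    obtain ⟨w, hw, z, hz, hx⟩ := exists_stdSimplex_of_mem_convexHull hd.le hx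
    exact ⟨(w, z), ⟨hw, fun i _ => hz i⟩, hx⟩
  · rintro ⟨⟨w, z⟩, ⟨hw, hz⟩, rfl⟩
    exact (convex_convexHull ℝ s).sum_mem (fun i _ => hw.1 i) hw.2
      fun i _ => subset_convexHull ℝ s (hz i trivial)

/-! ### Mixtures over a time-sharing variable -/

namespace InfoTheory

section Mixture

variable {Q Z α β γ δ : Type*} [Fintype Q] [Fintype Z] [Fintype α] [Fintype β] [Fintype γ]
  [Fintype δ]

open Classical in
theorem law_mixture {μ : Q × Z → ℝ} {pQ : Q → ℝ} {ν : Q → Z → ℝ}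
    (h : ∀ q z, μ (q, z) = pQ q * ν q z) {A : Type*} (f : Z → A) (a : A) (q : Q) :
    law μ (fun x => (f x.2, x.1)) (a, q) = pQ q * law (ν q) f a := by
  simp only [law, Fintype.sum_prod_type, Prod.mk.injEq, h, Finset.mul_sum]
  rw [Finset.sum_eq_single q]
  · simp
  · intro b _ hb
    simp [hb]
  · simp

/-- The chain rule for the mixing variable. Its own entropy is the first term; being the same for
every `f`, it cancels from conditional mutual informations. -/
theorem entropy_mixture {μ : Q × Z → ℝ} {pQ : Q → ℝ} {ν : Q → Z → ℝ}
    (h : ∀ q z, μ (q, z) = pQ q * ν q z) (hν : ∀ q z, 0 ≤ ν q z) (hν1 : ∀ q, ∑ z, ν q z = 1)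
    {A : Type*} (f : Z → A) :
    entropy μ (fun x => (f x.2, x.1)) =
      -(∑ q, pQ q * Real.logb 2 (pQ q)) + ∑ q, pQ q * entropy (ν q) f := by
  simp only [entropy, Fintype.sum_prod_type, law_mixture h, mul_neg, Finset.sum_neg_distrib]
  rw [← neg_add, ← Finset.sum_add_distrib]
  congr 1
  refine Finset.sum_congr rfl fun q _ => ?_
  rw [Finset.mul_sum, ← one_mul (Real.logb 2 (pQ q)), ← hν1 q, Finset.sum_mul, Finset.mul_sum,
    ← Finset.sum_add_distrib]
  refine Finset.sum_congr rfl fun z _ => ?_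
  rw [h]
  by_cases h1 : pQ q = 0
  · simp [h1]
  by_cases h2 : ν q z = 0
  · simp [h2]
  rw [Real.logb_mul h1 (law_pos (hν q) f h2).ne']
  ring

/-- Conditioning on the mixing variable as well averages the conditional mutual information. -/
theorem condMutualInfo_mixture {μ : Q × Z → ℝ} {pQ : Q → ℝ} {ν : Q → Z → ℝ}
    (h : ∀ q z, μ (q, z) = pQ q * ν q z) (hp : ∀ q, 0 ≤ pQ q) (hν : ∀ q z, 0 ≤ ν q z)
    (hν1 : ∀ q, ∑ z, ν q z = 1) (A : Z → α) (B : Z → β) (C : Z → γ) (C' : Q × Z → δ)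
    (hC : ∀ x y, C' x = C' y ↔ C x.2 = C y.2 ∧ x.1 = y.1) :
    condMutualInfo μ (fun x => A x.2) (fun x => B x.2) C'
      = ∑ q, pQ q * condMutualInfo (ν q) A B C := by
  have hμ : ∀ x, 0 ≤ μ x := fun x => by
    rw [← Prod.mk.eta (p := x), h]
    exact mul_nonneg (hp _) (hν _ _)
  -- `hC` fixes only the partition generated by `C'`, so any bracketing of the conditioning tuple is
  -- covered.
  rw [condMutualInfo_eq_entropy hμ,
    entropy_congr μ (A := fun x => (A x.2, C' x)) (B := fun x => ((A x.2, C x.2), x.1))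
      (by intro x y; simp [hC, and_assoc]),
    entropy_congr μ (A := fun x => (B x.2, C' x)) (B := fun x => ((B x.2, C x.2), x.1))
      (by intro x y; simp [hC, and_assoc]),
    entropy_congr μ (A := fun x => (A x.2, B x.2, C' x))
      (B := fun x => ((A x.2, B x.2, C x.2), x.1)) (by intro x y; simp [hC, and_assoc]),
    entropy_congr μ (A := C') (B := fun x => (C x.2, x.1)) (by intro x y; simp [hC]),
    entropy_mixture h hν hν1 (fun z => (A z, C z)), entropy_mixture h hν hν1 (fun z => (B z, C z)),
    entropy_mixture h hν hν1 (fun z => (A z, B z, C z)), entropy_mixture h hν hν1 C]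
  simp only [fun q => condMutualInfo_eq_entropy (hν q) A B C, mul_sub, mul_add,
    Finset.sum_sub_distrib, Finset.sum_add_distrib]
  ring

end Mixture

end InfoTheory

/-! ### The rate region as the lower closure of a compact convex hull -/

namespace DMIC

variable {X Y : Fin 3 → Type*} [∀ i, Fintype (X i)] [∀ i, Fintype (Y i)]

theorem sum_prod_eq_one {ι : Type*} [Fintype ι] [DecidableEq ι] {α : ι → Type*}
    [∀ i, Fintype (α i)] {p : ∀ i, α i → ℝ} (hp : ∀ i, ∑ a, p i a = 1) :
    ∑ x : ∀ i, α i, ∏ i, p i (x i) = 1 := by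
  rw [← Fintype.prod_sum]
  simp [hp]

theorem jointLaw_nonneg (W : DMIC X Y) {p : ∀ i, X i → ℝ} (hp : ∀ i, p i ∈ stdSimplex ℝ (X i))
    (z) : 0 ≤ W.jointLaw p z :=
  mul_nonneg (Finset.prod_nonneg fun i _ => (hp i).1 _) ((W.trans_mem _).1 _)

theorem sum_jointLaw (W : DMIC X Y) {p : ∀ i, X i → ℝ} (hp : ∀ i, p i ∈ stdSimplex ℝ (X i)) :
    ∑ z, W.jointLaw p z = 1 := by
  simp only [jointLaw, Fintype.sum_prod_type, ← Finset.mul_sum, (W.trans_mem _).2, mul_one]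
  exact sum_prod_eq_one fun i => (hp i).2

theorem timeSharingLaw_eq {Q : Type*} (W : DMIC X Y) (pQ : Q → ℝ) (p : ∀ i, Q → X i → ℝ) (q : Q)
    (z) : W.timeSharingLaw pQ p (q, z) = pQ q * W.jointLaw (fun i => p i q) z := by
  simp only [timeSharingLaw, jointLaw, mul_assoc]

/-- The six mutual informations that bound the rates, for a product input distribution. -/
noncomputable def rateBound (W : DMIC X Y) (p : ∀ i, X i → ℝ) (i : Fin 3) : ℝ × ℝ :=
  (condMutualInfo (W.jointLaw p) (fun z => z.1 i) (fun z => z.2 i)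
      (fun z => (z.1 (i + 1), z.1 (i + 2))),
    condMutualInfo (W.jointLaw p) (fun z => (z.1 i, z.1 (i + 1))) (fun z => z.2 i)
      (fun z => z.1 (i + 2)))

/-- The upper constraints become a single vector inequality against a convex combination of values
of `rateBound`, so all choices of `Q` together amount to a convex hull. -/
theorem rateBounds_timeSharingLaw_iff {Q : Type*} [Fintype Q] (W : DMIC X Y) {pQ : Q → ℝ}
    {p : ∀ i, Q → X i → ℝ} (hQ : pQ ∈ stdSimplex ℝ Q) (hp : ∀ i q, p i q ∈ stdSimplex ℝ (X i))
    (R : Fin 3 → ℝ) :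
    RateBounds (W.timeSharingLaw pQ p) R ↔ (∀ i, 0 ≤ R i) ∧
      (fun i => (R i, R i + R (i + 1))) ≤ ∑ q, pQ q • W.rateBound (fun i => p i q) := by
  have h := W.timeSharingLaw_eq pQ p
  have hν := fun q => W.jointLaw_nonneg fun i => hp i q
  have hν1 := fun q => W.sum_jointLaw fun i => hp i q
  simp only [RateBounds, Pi.le_def, Finset.sum_apply, Prod.le_def, Prod.fst_sum, Prod.snd_sum,
    Pi.smul_apply, Prod.smul_fst, Prod.smul_snd, rateBound, smul_eq_mul, ← forall_and]
  refine forall_congr' fun i => and_congr Iff.rfl (and_congr ?_ ?_)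
  · rw [condMutualInfo_mixture h hQ.1 hν hν1 (fun z => z.1 i) (fun z => z.2 i)
      (fun z => (z.1 (i + 1), z.1 (i + 2))) _ (by simp [and_assoc])]
  · rw [condMutualInfo_mixture h hQ.1 hν hν1 (fun z => (z.1 i, z.1 (i + 1))) (fun z => z.2 i)
      (fun z => z.1 (i + 2)) _ (by simp)]

theorem continuous_entropy_jointLaw (W : DMIC X Y) {α : Type*} [Fintype α]
    (A : (∀ i, X i) × (∀ i, Y i) → α) : Continuous fun p => entropy (W.jointLaw p) A := by
  simp only [entropy_eq_sum_negMulLog]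
  refine (continuous_finsetSum _ fun a _ => Real.continuous_negMulLog.comp ?_).div_const _
  refine continuous_finsetSum _ fun z _ => ?_
  split_ifs
  · unfold jointLaw
    fun_prop
  · exact continuous_const

/-- Restricted to the simplices because rewriting the informations as entropies needs a nonnegative
law. -/
theorem continuousOn_rateBound (W : DMIC X Y) :
    ContinuousOn W.rateBound (Set.univ.pi fun i => stdSimplex ℝ (X i)) := by
  refine continuousOn_pi.2 fun i => ContinuousOn.prodMk ?_ ?_
  · refine ContinuousOn.congr (f := fun p => _) ?_ fun p hp =>
      condMutualInfo_eq_entropy (W.jointLaw_nonneg fun i => hp i trivial) _ _ _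
    exact ((((W.continuous_entropy_jointLaw _).add (W.continuous_entropy_jointLaw _)).sub
      (W.continuous_entropy_jointLaw _)).sub (W.continuous_entropy_jointLaw _)).continuousOn
  · refine ContinuousOn.congr (f := fun p => _) ?_ fun p hp =>
      condMutualInfo_eq_entropy (W.jointLaw_nonneg fun i => hp i trivial) _ _ _
    exact ((((W.continuous_entropy_jointLaw _).add (W.continuous_entropy_jointLaw _)).sub
      (W.continuous_entropy_jointLaw _)).sub (W.continuous_entropy_jointLaw _)).continuousOn

/-- The rate bounds that time sharing can produce. -/
def rateBoundHull (W : DMIC X Y) : Set (Fin 3 → ℝ × ℝ) :=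
  convexHull ℝ (W.rateBound '' Set.univ.pi fun i => stdSimplex ℝ (X i))

theorem isCompact_rateBoundHull (W : DMIC X Y) : IsCompact W.rateBoundHull :=
  ((isCompact_univ_pi fun i => isCompact_stdSimplex ℝ (X i)).image_of_continuousOn
    W.continuousOn_rateBound).convexHull_of_finiteDimensional

open Pointwise in
-- The lower closure is the Minkowski sum of a compact set and the closed cone `Set.Iic 0`.
theorem isClosed_lowerClosure_rateBoundHull (W : DMIC X Y) :
    IsClosed {u | ∃ v ∈ W.rateBoundHull, u ≤ v} := by
  convert isClosed_Iic.add_left_of_isCompact W.isCompact_rateBoundHull (t := Set.Iic 0) using 1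
  ext u
  simp only [Set.mem_ofPred_eq, Set.mem_add, Set.mem_Iic]
  constructor
  · rintro ⟨v, hv, h⟩
    exact ⟨v, hv, _, sub_nonpos.2 h, add_sub_cancel _ _⟩
  · rintro ⟨v, hv, y, hy, h⟩
    exact ⟨v, hv, h ▸ add_le_of_nonpos_right hy⟩

/-- By Carathéodory's theorem in dimension `6`, seven values of the time-sharing variable
suffice. -/
theorem setOf_rateBounds_eq (W : DMIC X Y) :
    {R : Fin 3 → ℝ | ∃ m : ℕ, m ≤ 7 ∧ ∃ pQ : Fin m → ℝ, ∃ p : ∀ i, Fin m → X i → ℝ,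
        pQ ∈ stdSimplex ℝ (Fin m) ∧ (∀ i q, p i q ∈ stdSimplex ℝ (X i)) ∧
        RateBounds (W.timeSharingLaw pQ p) R} =
      {R | (∀ i, 0 ≤ R i) ∧ ∃ v ∈ W.rateBoundHull, (fun i => (R i, R i + R (i + 1))) ≤ v} := by
  ext R
  constructor
  · rintro ⟨m, -, pQ, p, hQ, hp, h⟩
    obtain ⟨h0, h⟩ := (W.rateBounds_timeSharingLaw_iff hQ hp R).1 h
    refine ⟨h0, _, ?_, h⟩
    exact (convex_convexHull ℝ _).sum_mem (fun i _ => hQ.1 i) hQ.2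
      fun q _ => subset_convexHull ℝ _ ⟨_, fun i _ => hp i q, rfl⟩
  · rintro ⟨h0, v, hv, h⟩
    obtain ⟨w, hw, z, hz, rfl⟩ := exists_stdSimplex_of_mem_convexHull (d := 7)
      (by simp [Module.finrank_pi_fintype, Module.finrank_prod]) hv
    choose p hp hz using hz
    obtain rfl : (fun q => W.rateBound (p q)) = z := funext hz
    refine ⟨7, le_rfl, w, fun i q => p q i, hw, fun i q => hp q i trivial, ?_⟩
    exact (W.rateBounds_timeSharingLaw_iff hw (fun i q => hp q i trivial) R).2 ⟨h0, h⟩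

end DMIC

/-! ### Resampling and memoryless outputs -/

namespace InfoTheory

section Resample

variable {ι : Type*} [Fintype ι] [DecidableEq ι] {α : ι → Type*} [∀ i, Fintype (α i)]

/-- Resampling one coordinate of a product law does not change expectations. -/
theorem sum_prod_mul_update {p : ∀ i, α i → ℝ} {j : ι} (hp : ∑ a, p j a = 1)
    (f : (∀ i, α i) → ℝ) :
    ∑ x, (∏ i, p i (x i)) * f x
      = ∑ x, (∏ i, p i (x i)) * ∑ a, p j a * f (Function.update x j a) := by
  -- The involution that swaps the `j`-th coordinate with a fresh sample; it preserves the product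
  -- weight.
  let e : (∀ i, α i) × α j ≃ (∀ i, α i) × α j :=
    { toFun := fun s => (Function.update s.1 j s.2, s.1 j)
      invFun := fun s => (Function.update s.1 j s.2, s.1 j)
      left_inv := fun s => by simp
      right_inv := fun s => by simp }
  have h1 : ∑ x, (∏ i, p i (x i)) * f x
      = ∑ s : (∀ i, α i) × α j, (∏ i, p i (s.1 i)) * p j s.2 * f s.1 := by
    rw [Fintype.sum_prod_type]
    refine Finset.sum_congr rfl fun x _ => ?_
    simp only [mul_right_comm _ (p j _), ← Finset.mul_sum, hp, mul_one]
  rw [h1, ← e.sum_comp, Fintype.sum_prod_type]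
  refine Finset.sum_congr rfl fun x _ => ?_
  rw [Finset.mul_sum]
  refine Finset.sum_congr rfl fun a _ => ?_
  simp only [e, Equiv.coe_fn_mk]
  rw [← mul_assoc]
  congr 1
  rw [← Finset.mul_prod_erase _ _ (Finset.mem_univ j), ← Finset.mul_prod_erase _ (fun i => p i (x i))
    (Finset.mem_univ j), Finset.prod_congr rfl (g := fun i => p i (x i)) fun i hi => by
      rw [Function.update_of_ne (Finset.ne_of_mem_erase hi)]]
  simp only [Function.update_self]
  ring

end Resample

section Memoryless

variable {S B U D : Type*} {n : ℕ}

/-- The law of a state together with outputs that are conditionally independent given it. -/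
def memorylessLaw (π : S → ℝ) (k : S → Fin n → B → ℝ) : S × (Fin n → B) → ℝ :=
  fun z => π z.1 * ∏ t, k z.1 t (z.2 t)

variable {π : S → ℝ} {k : S → Fin n → B → ℝ}

theorem memorylessLaw_nonneg (hπ : ∀ s, 0 ≤ π s) (hk : ∀ s t b, 0 ≤ k s t b) (z) :
    0 ≤ memorylessLaw π k z :=
  mul_nonneg (hπ _) (Finset.prod_nonneg fun _ _ => hk _ _ _)

variable [Fintype S] [Fintype B]

theorem sum_memorylessLaw_mul (hk1 : ∀ s t, ∑ b, k s t b = 1) (f : S → ℝ) :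
    ∑ z, memorylessLaw π k z * f z.1 = ∑ s, π s * f s := by
  simp only [memorylessLaw, Fintype.sum_prod_type, mul_right_comm _ _ (f _), ← Finset.mul_sum]
  refine Finset.sum_congr rfl fun s _ => ?_
  rw [← Fintype.prod_sum (fun t b => k s t b)]
  simp [hk1]

open Classical in
/-- The `t`-th output depends on anything that does not involve it through its kernel only. -/
theorem law_memorylessLaw (hk1 : ∀ s t, ∑ b, k s t b = 1) (t : Fin n) (F : S × (Fin n → B) → U)
    (hF : ∀ s y b, F (s, Function.update y t b) = F (s, y)) (κ : U → B → ℝ)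
    (hκ : ∀ s y, k s t = κ (F (s, y))) (o : B → D) (u : U) (d : D) :
    law (memorylessLaw π k) (fun z => (o (z.2 t), F z)) (d, u)
      = law (memorylessLaw π k) F u * law (κ u) o d := by
  have h : ∀ s, ∑ y : Fin n → B, (∏ τ, k s τ (y τ)) * (if o (y t) = d ∧ F (s, y) = u then 1 else 0)
      = ∑ y : Fin n → B, (∏ τ, k s τ (y τ)) * (if F (s, y) = u then law (κ u) o d else 0) := by
    intro s
    -- Resampling the `t`-th output leaves `F` unchanged and turns the indicator of `o (y t) = d`
    -- into its kernel probability.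
    rw [sum_prod_mul_update (hk1 s t)]
    refine Finset.sum_congr rfl fun y _ => ?_
    congr 1
    simp only [Function.update_self, hF]
    by_cases hu : F (s, y) = u
    · simp [hu, law, hκ s y]
    · simp [hu]
  simp only [law, memorylessLaw, Fintype.sum_prod_type, Prod.mk.injEq, Finset.sum_mul]
  refine Finset.sum_congr rfl fun s _ => ?_
  have := congrArg (π s * ·) (h s)
  simp only [Finset.mul_sum, mul_ite, mul_one, mul_zero] at this
  rw [this]
  refine Finset.sum_congr rfl fun y _ => ?_
  by_cases hu : F (s, y) = u
  · simp only [hu, if_true, mul_assoc]; rfl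
  · simp [hu]

/-- The entropy of the observation `o` of the `t`-th output given the state. -/
noncomputable def noiseEntropy (π : S → ℝ) (k : S → Fin n → B → ℝ) (t : Fin n) (o : B → D) : ℝ :=
  -∑ z, memorylessLaw π k z * Real.logb 2 (law (k z.1 t) o (o (z.2 t)))

/-- `F` determines the kernel at time `t` and does not involve the `t`-th output, so given `F` that
output contributes pure noise. The increment does not depend on `F`, which lets noise terms cancel
in the converse. -/
theorem entropy_memorylessLaw (hπ : ∀ s, 0 ≤ π s) (hk : ∀ s t b, 0 ≤ k s t b)
    (hk1 : ∀ s t, ∑ b, k s t b = 1) (t : Fin n) (F : S × (Fin n → B) → U)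
    (hF : ∀ s y b, F (s, Function.update y t b) = F (s, y))
    (hκ : ∀ z z', F z = F z' → k z.1 t = k z'.1 t) (o : B → D) :
    entropy (memorylessLaw π k) (fun z => (o (z.2 t), F z))
      = entropy (memorylessLaw π k) F + noiseEntropy π k t o := by
  classical
  have h : ∀ z, law (memorylessLaw π k) (fun z => (o (z.2 t), F z)) (o (z.2 t), F z)
      = law (memorylessLaw π k) F (F z) * law (k z.1 t) o (o (z.2 t)) := by
    intro z
    -- `hκ` says that the kernel factors through `F`; a factor is picked by choice, with the
    -- irrelevant value `0` off the range of `F`.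
    have := law_memorylessLaw (π := π) hk1 t F hF
      (fun u => if h : ∃ z, F z = u then k h.choose.1 t else 0) (fun s y => by
        have hex : ∃ z, F z = F (s, y) := ⟨_, rfl⟩
        rw [dif_pos hex]
        exact (hκ _ (s, y) hex.choose_spec).symm) o (F z) (o (z.2 t))
    rw [this]
    have hex : ∃ z', F z' = F z := ⟨_, rfl⟩
    rw [dif_pos hex, hκ _ _ hex.choose_spec]
  simp only [entropy, noiseEntropy, ← neg_add, ← Finset.sum_add_distrib, h]
  congr 1
  refine Finset.sum_congr rfl fun z _ => ?_
  by_cases h0 : memorylessLaw π k z = 0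
  · simp [h0]
  have h1 := law_pos (memorylessLaw_nonneg hπ hk) F h0
  have h2 := law_pos (memorylessLaw_nonneg hπ hk) (fun z => (o (z.2 t), F z)) h0
  rw [h z] at h2
  rw [Real.logb_mul h1.ne' (pos_of_mul_pos_right h2 h1.le).ne', mul_add]

/-- Chain rule for the noise entropies. -/
theorem entropy_state_outputs (hπ : ∀ s, 0 ≤ π s) (hk : ∀ s t b, 0 ≤ k s t b)
    (hk1 : ∀ s t, ∑ b, k s t b = 1) (o : B → D) :
    entropy (memorylessLaw π k) (fun z => (fun t => o (z.2 t), z.1))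
      = entropy (memorylessLaw π k) (fun z => z.1) + ∑ t, noiseEntropy π k t o := by
  classical
  -- Outputs before time `m` are revealed and the rest masked, so that all prefixes live in one
  -- type.
  let F : ℕ → S × (Fin n → B) → (Fin n → Option D) × S :=
    fun m z => (fun t => if (t : ℕ) < m then some (o (z.2 t)) else none, z.1)
  have key : ∀ m (hm : m ≤ n), entropy (memorylessLaw π k) (F m)
      = entropy (memorylessLaw π k) (fun z => z.1)
        + ∑ t : Fin m, noiseEntropy π k (Fin.castLE hm t) o := by
    intro m
    induction m with
    | zero =>
      intro _
      rw [entropy_congr _ (A := F 0) (B := fun z => z.1) (by intro z z'; simp [F])]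
      simp
    | succ m ih =>
      intro hm
      have hmn : m < n := hm
      have := entropy_memorylessLaw hπ hk hk1 ⟨m, hmn⟩ (F m) (fun s y b => by
        simp only [F, Prod.mk.injEq, and_true]
        funext t
        by_cases ht : (t : ℕ) < m
        · have : t ≠ ⟨m, hmn⟩ := fun h => by rw [h] at ht; simp at ht
          simp [ht, Function.update_of_ne this]
        · simp [ht]) (fun z z' h => by
          have h2 : z.1 = z'.1 := (Prod.ext_iff.1 h).2
          rw [h2]) o
      rw [entropy_congr _ (B := F (m + 1)), ih hmn.le] at this
      · rw [this, Fin.sum_univ_castSucc, add_assoc]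
        rfl
      · intro z z'
        simp only [F, Prod.mk.injEq, funext_iff, ← and_assoc]
        refine and_congr ⟨?_, fun h => ⟨?_, fun t => ?_⟩⟩ Iff.rfl
        · rintro ⟨h1, h2⟩ t
          rcases lt_trichotomy (t : ℕ) m with ht | ht | ht
          · have := h2 t
            simp only [ht, if_true] at this
            simp [this]
          · have : t = ⟨m, hmn⟩ := Fin.ext ht
            simp [this, h1]
          · simp [Nat.not_lt.2 (Nat.succ_le_of_lt ht)]
        · simpa using h ⟨m, hmn⟩
        · have := h t
          by_cases ht : (t : ℕ) < m
          · simpa [ht, ht.trans (Nat.lt_succ_self m)] using this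
          · simp [ht]
  have := key n le_rfl
  rw [entropy_congr _ (B := fun z => (fun t => o (z.2 t), z.1))] at this
  · exact this
  · intro z z'
    simp [F, funext_iff]

end Memoryless

/-! ### Single-letterization by the chain rule -/

section Chain

variable {Ω D : Type*} [Fintype Ω] [Fintype D] {n : ℕ} {T : Fin n → Type*} [∀ t, Fintype (T t)]
  {β : Type*} [Fintype β]

/-- The entropy of a sequence is at most the sum of the letter entropies, where each letter may
be conditioned on less. -/
theorem entropy_seq_le {μ : Ω → ℝ} (hμ : ∀ ω, 0 ≤ μ ω) (A : Ω → Fin n → β) (C : Ω → D)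
    (E : ∀ t, Ω → T t) (hE : ∀ t ω ω', C ω = C ω' → E t ω = E t ω') :
    entropy μ (fun ω => (A ω, C ω)) ≤ entropy μ C
      + ∑ t, (entropy μ (fun ω => (A ω t, E t ω)) - entropy μ (E t)) := by
  classical
  let F : ℕ → Ω → (Fin n → Option β) × D :=
    fun m ω => (fun t => if (t : ℕ) < m then some (A ω t) else none, C ω)
  have key : ∀ m (hm : m ≤ n), entropy μ (F m) ≤ entropy μ C
      + ∑ t : Fin m, (entropy μ (fun ω => (A ω (Fin.castLE hm t), E (Fin.castLE hm t) ω))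
        - entropy μ (E (Fin.castLE hm t))) := by
    intro m
    induction m with
    | zero =>
      intro _
      rw [entropy_congr _ (A := F 0) (B := C) (by intro z z'; simp [F])]
      simp
    | succ m ih =>
      intro hm
      have hmn : m < n := hm
      -- Conditioning on the prefix and `C` is weakened to conditioning on `E`, a function of `C`.
      have := entropy_submodular hμ (fun ω => A ω ⟨m, hmn⟩) (F m) (E ⟨m, hmn⟩)
      rw [entropy_congr _ (A := fun ω => (F m ω, E ⟨m, hmn⟩ ω)) (B := F m),
        entropy_congr _ (A := fun ω => (A ω ⟨m, hmn⟩, F m ω, E ⟨m, hmn⟩ ω)) (B := F (m + 1))] at this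
      · rw [Fin.sum_univ_castSucc]
        have h2 := ih hmn.le
        simp only [Fin.castLE_castSucc] at h2 ⊢
        have h3 : Fin.castLE hm (Fin.last m) = ⟨m, hmn⟩ := rfl
        rw [h3]
        linarith
      · intro z z'
        simp only [F, Prod.mk.injEq, funext_iff]
        constructor
        · rintro ⟨h1, ⟨h2, h3⟩, -⟩
          refine ⟨fun t => ?_, h3⟩
          rcases lt_trichotomy (t : ℕ) m with ht | ht | ht
          · have := h2 t
            simp only [ht, if_true] at this
            simp [this]
          · have : t = ⟨m, hmn⟩ := Fin.ext ht
            simp [this, h1]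
          · simp [Nat.not_lt.2 (Nat.succ_le_of_lt ht)]
        · rintro ⟨h, h3⟩
          refine ⟨by simpa using h ⟨m, hmn⟩, ⟨fun t => ?_, h3⟩, hE _ _ _ h3⟩
          have := h t
          by_cases ht : (t : ℕ) < m
          · simpa [ht, ht.trans (Nat.lt_succ_self m)] using this
          · simp [ht]
      · intro z z'
        simp only [F, Prod.mk.injEq]
        exact ⟨fun h => h.1, fun h => ⟨h, hE _ _ _ h.2⟩⟩
  have := key n le_rfl
  rw [entropy_congr _ (B := fun ω => (A ω, C ω))] at this
  · exact this
  · intro z z'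
    simp [F, funext_iff]

end Chain

end InfoTheory

/-! ### The law induced by a code, and strong interference for blocks -/

namespace InfoTheory

open Classical in
theorem sum_law_pair {Ω α β : Type*} [Fintype Ω] [Fintype β] (μ : Ω → ℝ) (A : Ω → α) (B : Ω → β)
    (a : α) : ∑ b, law μ (fun ω => (A ω, B ω)) (a, b) = law μ A a := by
  simp only [law, Prod.mk.injEq]
  rw [Finset.sum_comm]
  refine Finset.sum_congr rfl fun ω _ => ?_
  by_cases h : A ω = a <;> simp [h]

theorem law_id {Ω : Type*} [Fintype Ω] (μ : Ω → ℝ) (ω : Ω) : law μ (fun ω => ω) ω = μ ω := by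
  rw [law, Finset.sum_eq_single ω]
  · simp
  · intro ω' _ h
    simp [h]
  · simp

end InfoTheory

theorem Fin.eq_or_eq_add_one_or_eq_add_two (i l : Fin 3) : l = i ∨ l = i + 1 ∨ l = i + 2 := by
  decide +revert

theorem Fin.add_one_ne_self_of_three (i : Fin 3) : i + 1 ≠ i := by decide +revert

theorem Fin.add_two_ne_self_of_three (i : Fin 3) : i + 2 ≠ i := by decide +revert

theorem funext_fin_three_iff {α : Fin 3 → Type*} (i : Fin 3) (x x' : ∀ l, α l) :
    x = x' ↔ x i = x' i ∧ x (i + 1) = x' (i + 1) ∧ x (i + 2) = x' (i + 2) := by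
  refine ⟨fun h => by rw [h]; exact ⟨rfl, rfl, rfl⟩, fun ⟨h1, h2, h3⟩ => funext fun l => ?_⟩
  rcases i.eq_or_eq_add_one_or_eq_add_two l with rfl | rfl | rfl <;> assumption

namespace DMICCode

variable {X Y : Fin 3 → Type*} {n : ℕ} {M : Fin 3 → ℕ}

/-- The channel inputs at time `t`. -/
def input (c : DMICCode X Y n M) (w : ∀ i, Fin (M i)) (t : Fin n) (i : Fin 3) : X i :=
  c.enc i (w i) t

/-- The distribution of the `i`-th input at time `t` for a uniform message. -/
noncomputable def inputLaw (c : DMICCode X Y n M) (t : Fin n) (i : Fin 3) : X i → ℝ :=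
  law (fun _ : Fin (M i) => (M i : ℝ)⁻¹) (fun m => c.enc i m t)

theorem inputLaw_mem [∀ i, Fintype (X i)] (c : DMICCode X Y n M) (hM : ∀ i, 0 < M i) (t : Fin n)
    (i : Fin 3) : c.inputLaw t i ∈ stdSimplex ℝ (X i) := by
  have := hM i
  refine ⟨law_nonneg (fun _ => by positivity) _, ?_⟩
  rw [inputLaw, sum_law]
  simp [this.ne']

end DMICCode

namespace DMIC

variable {X Y : Fin 3 → Type*} [∀ i, Fintype (X i)] [∀ i, Fintype (Y i)] {n : ℕ} {M : Fin 3 → ℕ}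

/-- The joint law of the messages and the channel outputs. -/
noncomputable def codeLaw (W : DMIC X Y) (c : DMICCode X Y n M) :
    (∀ i, Fin (M i)) × (Fin n → ∀ i, Y i) → ℝ :=
  memorylessLaw (fun _ => (∏ i, (M i : ℝ))⁻¹) (fun w t => W.trans (c.input w t))

theorem codeLaw_nonneg (W : DMIC X Y) (c : DMICCode X Y n M) (z) : 0 ≤ W.codeLaw c z :=
  memorylessLaw_nonneg (fun _ => by positivity) (fun _ _ => (W.trans_mem _).1) _

theorem sum_codeLaw_mul (W : DMIC X Y) (c : DMICCode X Y n M) (f : (∀ i, Fin (M i)) → ℝ) :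
    ∑ z, W.codeLaw c z * f z.1 = (∏ i, (M i : ℝ))⁻¹ * ∑ w, f w := by
  rw [codeLaw, sum_memorylessLaw_mul fun _ _ => (W.trans_mem _).2, Finset.mul_sum]

theorem sum_codeLaw (W : DMIC X Y) (c : DMICCode X Y n M) (hM : ∀ i, 0 < M i) :
    ∑ z, W.codeLaw c z = 1 := by
  have := W.sum_codeLaw_mul c fun _ => 1
  simp only [mul_one, Finset.sum_const, Finset.card_univ, Fintype.card_pi, Fintype.card_fin,
    nsmul_eq_mul, Nat.cast_prod] at this
  rw [this, inv_mul_cancel₀]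
  exact Finset.prod_ne_zero_iff.2 fun i _ => Nat.cast_ne_zero.2 (hM i).ne'

-- Independence of the messages makes the inputs at each time independent, so each channel use
-- contributes a point of `rateBoundHull`.
open Classical in
theorem law_codeLaw_input (W : DMIC X Y) (c : DMICCode X Y n M) (t : Fin n) (x : ∀ i, X i) :
    law (W.codeLaw c) (fun z => c.input z.1 t) x = ∏ i, c.inputLaw t i (x i) := by
  have := W.sum_codeLaw_mul c fun w => if c.input w t = x then 1 else 0
  simp only [mul_ite, mul_one, mul_zero] at this
  refine (Eq.trans (by simp only [law]; congr!) this).trans ?_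
  rw [← Finset.prod_inv_distrib, Finset.mul_sum]
  simp only [DMICCode.inputLaw, law]
  rw [Fintype.prod_sum]
  refine Finset.sum_congr rfl fun w _ => ?_
  by_cases h : c.input w t = x
  · rw [if_pos h, mul_one]
    exact Finset.prod_congr rfl fun i _ => (if_pos (congrFun h i)).symm
  · rw [if_neg h, mul_zero]
    obtain ⟨i, hi⟩ := Function.ne_iff.1 h
    exact (Finset.prod_eq_zero (Finset.mem_univ i) (if_neg hi)).symm

/-- The Markov chain from `U` through the `t`-th inputs to the `t`-th outputs; `U` may involve the
messages and all other outputs. -/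
theorem law_codeLaw_state_output (W : DMIC X Y) (c : DMICCode X Y n M) (t : Fin n) {𝒰 : Type*}
    (U : (∀ i, Fin (M i)) × (Fin n → ∀ i, Y i) → 𝒰)
    (hU : ∀ w y b, U (w, Function.update y t b) = U (w, y)) (u : 𝒰) (x : ∀ i, X i) (y : ∀ i, Y i) :
    law (W.codeLaw c) (fun z => (U z, c.input z.1 t, z.2 t)) (u, x, y)
      = law (W.codeLaw c) (fun z => (U z, c.input z.1 t)) (u, x) * W.trans x y := by
  have := law_memorylessLaw (π := fun _ => (∏ i, (M i : ℝ))⁻¹)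
    (fun w t => (W.trans_mem (c.input w t)).2) t (fun z => (U z, c.input z.1 t))
    (fun w y b => by rw [hU]) (fun u => W.trans u.2) (fun _ _ => rfl) (fun b => b) (u, x) y
  rw [law_id] at this
  refine Eq.trans (law_congr _ fun z => ?_) this
  simp only [Prod.mk.injEq]
  tauto

theorem law_codeLaw_input_output (W : DMIC X Y) (c : DMICCode X Y n M) (t : Fin n) :
    law (W.codeLaw c) (fun z => (c.input z.1 t, z.2 t)) = W.jointLaw (c.inputLaw t) := by
  funext ⟨x, y⟩
  have := W.law_codeLaw_state_output c t (fun _ => ()) (fun _ _ _ => rfl) () x y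
  have e : law (W.codeLaw c) (fun z => c.input z.1 t) x
      = law (W.codeLaw c) (fun z => ((), c.input z.1 t)) ((), x) := law_congr _ (by simp)
  rw [jointLaw, ← W.law_codeLaw_input c t x, e, ← this]
  exact law_congr _ (by simp)

/-- The entropy of the `t`-th output at receiver `j` given all messages. -/
noncomputable def outputNoise (W : DMIC X Y) (c : DMICCode X Y n M) (t : Fin n) (j : Fin 3) : ℝ :=
  noiseEntropy (fun _ : ∀ i, Fin (M i) => (∏ i, (M i : ℝ))⁻¹)
    (fun w t => W.trans (c.input w t)) t (fun y => y j)

theorem entropy_output_state (W : DMIC X Y) (c : DMICCode X Y n M) (t : Fin n) (j : Fin 3)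
    {𝒰 : Type*} (U : (∀ i, Fin (M i)) × (Fin n → ∀ i, Y i) → 𝒰)
    (hU : ∀ w y b, U (w, Function.update y t b) = U (w, y))
    (hdet : ∀ z z', U z = U z' → c.input z.1 t = c.input z'.1 t) :
    entropy (W.codeLaw c) (fun z => (z.2 t j, U z))
      = entropy (W.codeLaw c) U + W.outputNoise c t j :=
  entropy_memorylessLaw (fun _ => by positivity) (fun _ _ => (W.trans_mem _).1)
    (fun _ _ => (W.trans_mem _).2) t U hU (fun z z' h => by simp only [hdet z z' h]) fun y => y j

/-- Strong interference, conditionally on a state that does not involve the `t`-th output and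
determines the `t`-th inputs of the other users. -/
theorem entropy_output_strong_le (W : DMIC X Y) (hs : W.CyclicStrong) (c : DMICCode X Y n M)
    (hM : ∀ i, 0 < M i) (t : Fin n) (i : Fin 3) {𝒰 : Type*} [Fintype 𝒰]
    (U : (∀ i, Fin (M i)) × (Fin n → ∀ i, Y i) → 𝒰)
    (hU : ∀ w y b, U (w, Function.update y t b) = U (w, y))
    (hdet : ∀ l ≠ i, ∀ z z', U z = U z' → c.input z.1 t l = c.input z'.1 t l) :
    entropy (W.codeLaw c) (fun z => (z.2 t i, U z)) - W.outputNoise c t i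
      ≤ entropy (W.codeLaw c) (fun z => (z.2 t (i + 2), U z)) - W.outputNoise c t (i + 2) := by
  classical
  set μ := W.codeLaw c with hμ_def
  have hμ : ∀ z, 0 ≤ μ z := W.codeLaw_nonneg c
  -- The conditional law of each input given `U = u`. On states of probability zero any point of the
  -- simplex would do.
  let p : 𝒰 → ∀ l, X l → ℝ := fun u l x =>
    if law μ U u = 0 then c.inputLaw t l x
    else law μ (fun z => (U z, c.input z.1 t l)) (u, x) / law μ U u
  have hp : ∀ u l, p u l ∈ stdSimplex ℝ (X l) := by
    intro u l
    by_cases h : law μ U u = 0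
    · simpa only [p, h, if_true] using c.inputLaw_mem hM t l
    · simp only [p, h, if_false]
      refine ⟨fun x => div_nonneg (law_nonneg hμ _ _) (law_nonneg hμ _ _), ?_⟩
      rw [← Finset.sum_div, sum_law_pair, div_self h]
  -- Given `U = u` every input except the `i`-th is deterministic, so the conditional input law is a
  -- product. This is why a hypothesis about product inputs suffices.
  have hfac : ∀ u x, law μ (fun z => (U z, c.input z.1 t)) (u, x)
      = law μ U u * ∏ l, p u l (x l) := by
    intro u x
    by_cases h : law μ U u = 0
    · rw [h, zero_mul]
      refine le_antisymm (h ▸ law_comp_mono hμ fun z hz => ?_) (law_nonneg hμ _ _)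
      exact (Prod.ext_iff.1 hz).1
    obtain ⟨z₀, hz₀⟩ : ∃ z, U z = u := by
      by_contra hne
      push Not at hne
      exact h (Finset.sum_eq_zero fun z _ => if_neg (hne z))
    by_cases hx : ∀ l ≠ i, c.input z₀.1 t l = x l
    · rw [Fintype.prod_eq_single i]
      · simp only [p, h, if_false]
        rw [mul_div_cancel₀ _ h]
        refine law_congr _ fun z => ?_
        simp only [Prod.mk.injEq]
        refine and_congr_right fun hz => ⟨fun e => by rw [e], fun e => funext fun l => ?_⟩
        by_cases hl : l = i
        · subst hl; exact e
        · rw [← hx l hl]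
          exact hdet l hl _ _ (hz.trans hz₀.symm)
      · intro l hl
        simp only [p, h, if_false]
        rw [div_eq_one_iff_eq h]
        refine law_congr _ fun z => ?_
        simp only [Prod.mk.injEq, and_iff_left_iff_imp]
        intro hz
        rw [← hx l hl]
        exact hdet l hl _ _ (hz.trans hz₀.symm)
    · push Not at hx
      obtain ⟨l, hl, hxl⟩ := hx
      have h0 : law μ (fun z => (U z, c.input z.1 t l)) (u, x l) = 0 := by
        refine Finset.sum_eq_zero fun z _ => if_neg fun hz => hxl ?_
        simp only [Prod.mk.injEq] at hz
        rw [← hz.2]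
        exact hdet l hl _ _ (hz₀.trans hz.1.symm)
      rw [Finset.prod_eq_zero (Finset.mem_univ l), mul_zero]
      · refine Finset.sum_eq_zero fun z _ => if_neg fun hz => hxl ?_
        simp only [Prod.mk.injEq] at hz
        rw [← hz.2]
        exact hdet l hl _ _ (hz₀.trans hz.1.symm)
      · simp only [p, h, if_false, h0, zero_div]
  set ν := law μ (fun z => (U z, c.input z.1 t, z.2 t)) with hν_def
  have hmix : ∀ u z, ν (u, z) = law μ U u * W.jointLaw (p u) z := by
    rintro u ⟨x, y⟩
    rw [hν_def, W.law_codeLaw_state_output c t U hU, hfac, jointLaw, mul_assoc]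
  -- `U` already determines the other two inputs, and with the `i`-th it determines all three. Hence
  -- the information is the entropy of the output given `U` minus noise.
  have hcond : ∀ j, condMutualInfo ν (fun z => z.2.1 i) (fun z => z.2.2 j)
      (fun z => ((z.2.1 (i + 1), z.2.1 (i + 2)), z.1))
      = entropy μ (fun z => (z.2 t j, U z)) - entropy μ U - W.outputNoise c t j := by
    intro j
    have hC : ∀ z z', ((c.input z.1 t (i + 1), c.input z.1 t (i + 2)), U z)
        = ((c.input z'.1 t (i + 1), c.input z'.1 t (i + 2)), U z') ↔ U z = U z' := by
      intro z z'
      simp only [Prod.mk.injEq, and_iff_right_iff_imp]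
      exact fun h => ⟨hdet _ i.add_one_ne_self_of_three _ _ h,
        hdet _ i.add_two_ne_self_of_three _ _ h⟩
    have hX : ∀ z z', c.input z.1 t i = c.input z'.1 t i ∧ U z = U z'
        ↔ U z = U z' ∧ c.input z.1 t = c.input z'.1 t := by
      intro z z'
      refine ⟨fun h => ⟨h.2, funext fun l => ?_⟩, fun h => ⟨by rw [h.2], h.1⟩⟩
      by_cases hl : l = i
      · subst hl; exact h.1
      · exact hdet l hl _ _ h.2
    have h1 := W.entropy_output_state c t j (fun z => (U z, c.input z.1 t))
      (fun w y b => by rw [hU]) (fun z z' h => (Prod.ext_iff.1 h).2)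
    rw [condMutualInfo_eq_entropy (law_nonneg hμ _), entropy_law, entropy_law, entropy_law,
      entropy_law, entropy_congr μ
        (A := fun z => ((c.input z.1 t (i + 1), c.input z.1 t (i + 2)), U z)) (B := U) hC,
      entropy_congr μ
        (A := fun z => (z.2 t j, (c.input z.1 t (i + 1), c.input z.1 t (i + 2)), U z))
        (B := fun z => (z.2 t j, U z)) (fun z z' => by
          have := hC z z'
          simp only [Prod.mk.injEq] at this ⊢
          tauto),
      entropy_congr μ
        (A := fun z => (c.input z.1 t i, (c.input z.1 t (i + 1), c.input z.1 t (i + 2)), U z))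
        (B := fun z => (U z, c.input z.1 t)) (fun z z' => by
          have := hC z z'
          have := hX z z'
          simp only [Prod.mk.injEq] at *
          tauto),
      entropy_congr μ
        (A := fun z => (c.input z.1 t i, z.2 t j,
          (c.input z.1 t (i + 1), c.input z.1 t (i + 2)), U z))
        (B := fun z => (z.2 t j, U z, c.input z.1 t)) (fun z z' => by
          have := hC z z'
          have := hX z z'
          simp only [Prod.mk.injEq] at *
          tauto), h1]
    ring
  have hle : condMutualInfo ν (fun z => z.2.1 i) (fun z => z.2.2 i)
      (fun z => ((z.2.1 (i + 1), z.2.1 (i + 2)), z.1))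
      ≤ condMutualInfo ν (fun z => z.2.1 i) (fun z => z.2.2 (i + 2))
      (fun z => ((z.2.1 (i + 1), z.2.1 (i + 2)), z.1)) := by
    have hmx := fun j => condMutualInfo_mixture hmix (law_nonneg hμ U)
      (fun u => W.jointLaw_nonneg (hp u)) (fun u => W.sum_jointLaw (hp u)) (fun z => z.1 i)
      (fun z => z.2 j) (fun z => (z.1 (i + 1), z.1 (i + 2)))
      (fun z => ((z.2.1 (i + 1), z.2.1 (i + 2)), z.1)) (fun x y => Prod.mk.injEq ..▸ Iff.rfl)
    rw [hmx, hmx]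
    exact Finset.sum_le_sum fun u _ =>
      mul_le_mul_of_nonneg_left (hs (p u) (hp u) i) (law_nonneg hμ U u)
  rw [hcond, hcond] at hle
  linarith

/-- Strong interference for whole blocks. -/
theorem entropy_outputs_strong_le (W : DMIC X Y) (hs : W.CyclicStrong) (c : DMICCode X Y n M)
    (hM : ∀ i, 0 < M i) (i : Fin 3) :
    entropy (W.codeLaw c) (fun z => (fun t => z.2 t i, z.1 (i + 1), z.1 (i + 2)))
        - ∑ t, W.outputNoise c t i
      ≤ entropy (W.codeLaw c) (fun z => (fun t => z.2 t (i + 2), z.1 (i + 1), z.1 (i + 2)))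
        - ∑ t, W.outputNoise c t (i + 2) := by
  classical
  -- Hybrid sequences: outputs of receiver `i` before time `m`, outputs of receiver `i + 2` from
  -- then on. Consecutive hybrids differ in one letter.
  let F : ℕ → (∀ i, Fin (M i)) × (Fin n → ∀ i, Y i) →
      (Fin n → Y i ⊕ Y (i + 2)) × Fin (M (i + 1)) × Fin (M (i + 2)) :=
    fun m z => (fun t => if (t : ℕ) < m then Sum.inl (z.2 t i) else Sum.inr (z.2 t (i + 2)),
      z.1 (i + 1), z.1 (i + 2))
  have key : ∀ m (hm : m ≤ n), entropy (W.codeLaw c) (F m)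
        - ∑ t : Fin m, W.outputNoise c (Fin.castLE hm t) i
      ≤ entropy (W.codeLaw c) (fun z => (fun t => z.2 t (i + 2), z.1 (i + 1), z.1 (i + 2)))
        - ∑ t : Fin m, W.outputNoise c (Fin.castLE hm t) (i + 2) := by
    intro m
    induction m with
    | zero =>
      intro _
      rw [entropy_congr _ (A := F 0)
        (B := fun z => (fun t => z.2 t (i + 2), z.1 (i + 1), z.1 (i + 2)))
        (by intro z z'; simp [F, funext_iff])]
      simp
    | succ m ih =>
      intro hm
      have hmn : m < n := hm
      let s : Fin n := ⟨m, hmn⟩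
      -- The common part of the hybrids `m` and `m + 1`, with the letter at time `m` erased. The two
      -- messages it retains determine the other users' inputs.
      let U : (∀ i, Fin (M i)) × (Fin n → ∀ i, Y i) →
          (Fin n → Option (Y i ⊕ Y (i + 2))) × Fin (M (i + 1)) × Fin (M (i + 2)) :=
        fun z => (fun t => if t = s then none else if (t : ℕ) < m then some (Sum.inl (z.2 t i))
          else some (Sum.inr (z.2 t (i + 2))), z.1 (i + 1), z.1 (i + 2))
      have h := W.entropy_output_strong_le hs c hM s i U (fun w y b => by
          simp only [U, Prod.mk.injEq, and_true]
          funext t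
          by_cases ht : t = s
          · simp [ht]
          · simp [ht]) (fun l hl z z' h => by
          simp only [U, Prod.mk.injEq] at h
          rcases (i.eq_or_eq_add_one_or_eq_add_two l).resolve_left hl with rfl | rfl
          · simp only [DMICCode.input, h.2.1]
          · simp only [DMICCode.input, h.2.2])
      have hU1 : entropy (W.codeLaw c) (fun z => (z.2 s i, U z)) = entropy (W.codeLaw c) (F (m + 1)) := by
        refine entropy_congr _ fun z z' => ?_
        simp only [U, F, Prod.mk.injEq, funext_iff, ← and_assoc]
        refine and_congr_left fun _ => and_congr_left fun _ => ⟨?_, fun h => ⟨?_, fun t => ?_⟩⟩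
        · rintro ⟨h1, h2⟩ t
          by_cases ht : t = s
          · simp [ht, h1, s]
          · have := h2 t
            have hne : (t : ℕ) ≠ m := fun e => ht (Fin.ext e)
            by_cases htm : (t : ℕ) < m
            · simpa [ht, htm, Nat.lt_succ_of_lt htm] using this
            · have h4 : ¬ (t : ℕ) < m + 1 := by omega
              rw [if_neg h4, if_neg h4]
              simpa [ht, htm] using this
        · simpa [s] using h s
        · by_cases ht : t = s
          · simp [ht]
          · have := h t
            have hne : (t : ℕ) ≠ m := fun e => ht (Fin.ext e)
            by_cases htm : (t : ℕ) < m
            · simpa [ht, htm, Nat.lt_succ_of_lt htm] using this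
            · have h4 : ¬ (t : ℕ) < m + 1 := by omega
              rw [if_neg h4, if_neg h4] at this
              simpa [ht, htm] using this
      have hU2 : entropy (W.codeLaw c) (fun z => (z.2 s (i + 2), U z)) = entropy (W.codeLaw c) (F m) := by
        refine entropy_congr _ fun z z' => ?_
        simp only [U, F, Prod.mk.injEq, funext_iff, ← and_assoc]
        refine and_congr_left fun _ => and_congr_left fun _ => ⟨?_, fun h => ⟨?_, fun t => ?_⟩⟩
        · rintro ⟨h1, h2⟩ t
          by_cases ht : t = s
          · simp [ht, h1, s]
          · have := h2 t
            by_cases htm : (t : ℕ) < m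
            · simpa [ht, htm] using this
            · simpa [ht, htm] using this
        · simpa [s] using h s
        · by_cases ht : t = s
          · simp [ht]
          · have := h t
            by_cases htm : (t : ℕ) < m
            · simpa [ht, htm] using this
            · simpa [ht, htm] using this
      rw [hU1, hU2] at h
      have h2 := ih hmn.le
      rw [Fin.sum_univ_castSucc, Fin.sum_univ_castSucc]
      simp only [Fin.castLE_castSucc] at h2 ⊢
      have h3 : Fin.castLE hm (Fin.last m) = s := rfl
      rw [h3]
      linarith
  have := key n le_rfl
  rw [entropy_congr _ (B := fun z => (fun t => z.2 t i, z.1 (i + 1), z.1 (i + 2)))] at this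
  · exact this
  · intro z z'
    simp [F, funext_iff]

end DMIC

/-! ### Fano's inequality and the converse -/

namespace InfoTheory

theorem entropy_pair_le {Ω α β : Type*} [Fintype Ω] [Fintype α] [Fintype β] {μ : Ω → ℝ}
    (hμ : ∀ ω, 0 ≤ μ ω) (h1 : ∑ ω, μ ω = 1) (A : Ω → α) (B : Ω → β) :
    entropy μ (fun ω => (A ω, B ω)) ≤ entropy μ A + entropy μ B := by
  have := entropy_submodular hμ A B (fun _ => ())
  rw [entropy_const h1, entropy_congr μ (B := fun ω => (A ω, B ω)) (by simp),
    entropy_congr μ (A := fun ω => (A ω, ())) (B := A) (by simp),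
    entropy_congr μ (A := fun ω => (B ω, ())) (B := B) (by simp)] at this
  linarith

/-- Fano's inequality, with the entropy of the error event bounded by one bit. -/
theorem entropy_pair_sub_le_of_estimate {Ω β : Type*} [Fintype Ω] [Fintype β] {μ : Ω → ℝ}
    (hμ : ∀ ω, 0 ≤ μ ω) (h1 : ∑ ω, μ ω = 1) {m : ℕ} (A : Ω → Fin m) (B : Ω → β)
    (dec : β → Fin m) :
    entropy μ (fun ω => (A ω, B ω)) - entropy μ B
      ≤ 1 + (∑ ω, if dec (B ω) ≠ A ω then μ ω else 0) * Real.logb 2 m := by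
  rcases Nat.eq_zero_or_pos m with rfl | hm
  · have : IsEmpty Ω := ⟨fun ω => (A ω).elim0⟩
    simp at h1
  have hm' : (1 : ℝ) ≤ m := by exact_mod_cast hm
  have hm0 : (0 : ℝ) < (2 * m : ℝ)⁻¹ := by positivity
  have hr : ∀ a b, (0 : ℝ) < (2 * m : ℝ)⁻¹ + if a = dec b then 1 / 2 else 0 := fun a b => by
    split_ifs <;> linarith
  -- Code with half the mass on the estimate and half spread uniformly: a correct estimate costs at
  -- most one bit, a wrong one `1 + logb 2 m`.
  refine (entropy_pair_sub_le hμ A B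
    (fun a b => (2 * m : ℝ)⁻¹ + if a = dec b then 1 / 2 else 0) (fun a b => (hr a b).le)
    (fun b => ?_) fun ω _ => hr _ _).trans ?_
  · rw [Finset.sum_add_distrib]
    simp only [Finset.sum_const, Finset.card_univ, Fintype.card_fin, nsmul_eq_mul,
      Finset.sum_ite_eq', Finset.mem_univ, if_true]
    have : (m : ℝ) * (2 * m : ℝ)⁻¹ = 1 / 2 := by field_simp
    rw [this]
    norm_num
  · have h2 : Real.logb 2 (1 / 2) = -1 := by
      rw [one_div, Real.logb_inv, Real.logb_self_eq_one (by norm_num)]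
    have h3 : Real.logb 2 (2 * m : ℝ)⁻¹ = -1 - Real.logb 2 m := by
      rw [Real.logb_inv, Real.logb_mul (by norm_num) (by positivity),
        Real.logb_self_eq_one (by norm_num)]
      ring
    have h4 : ∀ S : ℝ, 1 + S = ∑ ω, μ ω + S := fun S => by rw [h1]
    rw [Finset.sum_mul, h4, ← Finset.sum_neg_distrib, ← Finset.sum_add_distrib]
    refine Finset.sum_le_sum fun ω _ => ?_
    by_cases h : A ω = dec (B ω)
    · have : Real.logb 2 (1 / 2) ≤ Real.logb 2 ((2 * m : ℝ)⁻¹ + 1 / 2) :=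
        Real.logb_le_logb_of_le (by norm_num) (by norm_num) (by linarith)
      simp only [h, if_true, ne_eq, not_true_eq_false, if_false, zero_mul, add_zero]
      nlinarith [hμ ω]
    · simp only [h, if_false, add_zero, ne_eq, eq_comm, not_false_eq_true, if_true, h3]
      linarith

end InfoTheory

namespace DMIC

variable {X Y : Fin 3 → Type*} [∀ i, Fintype (X i)] [∀ i, Fintype (Y i)] {n : ℕ} {M : Fin 3 → ℕ}

theorem entropy_messages (W : DMIC X Y) (c : DMICCode X Y n M) (hM : ∀ i, 0 < M i) :
    entropy (W.codeLaw c) (fun z => z.1) = ∑ i, Real.logb 2 (M i) := by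
  have h : ∀ w, law (W.codeLaw c) (fun z => z.1) w = (∏ i, (M i : ℝ))⁻¹ := by
    intro w
    have := W.sum_codeLaw_mul c fun w' => if w' = w then 1 else 0
    simp only [mul_ite, mul_one, mul_zero, Finset.sum_ite_eq', Finset.mem_univ, if_true] at this
    rw [← this, law]
    congr!
  simp only [entropy, h]
  rw [← Finset.sum_mul, W.sum_codeLaw c hM, one_mul, Real.logb_inv, neg_neg,
    Real.logb_prod _ _ fun i _ => Nat.cast_ne_zero.2 (hM i).ne']

theorem entropy_message_le (W : DMIC X Y) (c : DMICCode X Y n M) (hM : ∀ i, 0 < M i) (i : Fin 3) :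
    entropy (W.codeLaw c) (fun z => z.1 i) ≤ Real.logb 2 (M i) := by
  simpa using entropy_le_logb_card (W.codeLaw_nonneg c) (W.sum_codeLaw c hM) (fun z => z.1 i)

theorem sum_fin_three (i : Fin 3) (f : Fin 3 → ℝ) : ∑ l, f l = f i + f (i + 1) + f (i + 2) := by
  rw [Fin.sum_univ_three]
  fin_cases i
  · rfl
  · change _ = f 1 + f 2 + f 0
    ring
  · change _ = f 2 + f 0 + f 1
    ring

theorem entropy_messages_eq (W : DMIC X Y) (c : DMICCode X Y n M) (hM : ∀ i, 0 < M i)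
    (i : Fin 3) :
    entropy (W.codeLaw c) (fun z => (z.1 i, z.1 (i + 1), z.1 (i + 2)))
      = Real.logb 2 (M i) + Real.logb 2 (M (i + 1)) + Real.logb 2 (M (i + 2)) := by
  rw [← sum_fin_three i fun i => Real.logb 2 (M i), ← W.entropy_messages c hM]
  exact entropy_congr _ fun z z' => by rw [funext_fin_three_iff i, Prod.mk.injEq, Prod.mk.injEq]

/-- Independence of `W i` from the other two messages, in the form that the genie hypothesis `hD` of
`logb_card_le_add_errorProb` requires. -/
theorem logb_card_le_of_two (W : DMIC X Y) (c : DMICCode X Y n M) (hM : ∀ i, 0 < M i)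
    (i : Fin 3) : Real.logb 2 (M i)
      ≤ entropy (W.codeLaw c) (fun z => (z.1 i, z.1 (i + 1), z.1 (i + 2)))
        - entropy (W.codeLaw c) (fun z => (z.1 (i + 1), z.1 (i + 2))) := by
  have h := entropy_pair_le (W.codeLaw_nonneg c) (W.sum_codeLaw c hM) (fun z => z.1 (i + 1))
    (fun z => z.1 (i + 2))
  have h1 := W.entropy_message_le c hM (i + 1)
  have h2 := W.entropy_message_le c hM (i + 2)
  rw [W.entropy_messages_eq c hM]
  linarith

theorem logb_card_le_of_one (W : DMIC X Y) (c : DMICCode X Y n M) (hM : ∀ i, 0 < M i)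
    (i : Fin 3) : Real.logb 2 (M i)
      ≤ entropy (W.codeLaw c) (fun z => (z.1 i, z.1 (i + 2)))
        - entropy (W.codeLaw c) (fun z => z.1 (i + 2)) := by
  have h := entropy_pair_le (W.codeLaw_nonneg c) (W.sum_codeLaw c hM) (fun z => z.1 (i + 1))
    (fun z => (z.1 i, z.1 (i + 2)))
  have h1 := W.entropy_message_le c hM (i + 1)
  have h2 := W.entropy_message_le c hM (i + 2)
  have h3 := W.entropy_messages_eq c hM i
  rw [entropy_congr _ (B := fun z => (z.1 (i + 1), z.1 i, z.1 (i + 2)))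
    (by intro z z'; simp only [Prod.mk.injEq]; tauto)] at h3
  linarith

open Classical in
theorem errorProb_eq (W : DMIC X Y) (c : DMICCode X Y n M) :
    W.errorProb c = ∑ z, if ∃ i, c.dec i (fun t => z.2 t i) ≠ z.1 i then W.codeLaw c z else 0 := by
  rw [errorProb, Fintype.sum_prod_type, Finset.mul_sum]
  refine Finset.sum_congr rfl fun w _ => ?_
  rw [Finset.mul_sum]
  refine Finset.sum_congr rfl fun y _ => ?_
  rw [mul_ite, mul_zero]
  congr!

/-- Fano's inequality for the message of user `i`, in the presence of a genie `D`. -/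
theorem logb_card_le_add_errorProb (W : DMIC X Y) (c : DMICCode X Y n M) (hM : ∀ i, 0 < M i)
    (i : Fin 3) {𝒟 : Type*} [Fintype 𝒟] (D : (∀ i, Fin (M i)) × (Fin n → ∀ i, Y i) → 𝒟)
    (hD : Real.logb 2 (M i) ≤ entropy (W.codeLaw c) (fun z => (z.1 i, D z))
      - entropy (W.codeLaw c) D) :
    Real.logb 2 (M i) ≤ 1 + W.errorProb c * Real.logb 2 (M i)
      + (entropy (W.codeLaw c) (fun z => (fun t => z.2 t i, D z)) - entropy (W.codeLaw c) D)
      - (entropy (W.codeLaw c) (fun z => (fun t => z.2 t i, z.1 i, D z))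
        - entropy (W.codeLaw c) (fun z => (z.1 i, D z))) := by
  classical
  have hμ := W.codeLaw_nonneg c
  -- Giving the genie to the receiver can only lower the remaining uncertainty about `W i`, so Fano
  -- without the genie suffices.
  have h1 := entropy_submodular hμ (fun z => z.1 i) D (fun z t => z.2 t i)
  have h2 := entropy_pair_sub_le_of_estimate hμ (W.sum_codeLaw c hM) (fun z => z.1 i)
    (fun z t => z.2 t i) (c.dec i)
  have h3 : (∑ z, if c.dec i (fun t => z.2 t i) ≠ z.1 i then W.codeLaw c z else 0)
      ≤ W.errorProb c := by
    rw [errorProb_eq]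
    refine Finset.sum_le_sum fun z _ => ?_
    by_cases h : c.dec i (fun t => z.2 t i) ≠ z.1 i
    · rw [if_pos h, if_pos ⟨i, h⟩]
    · rw [if_neg h]
      split_ifs
      exacts [hμ z, le_rfl]
  have hL : 0 ≤ Real.logb 2 (M i) :=
    Real.logb_nonneg (by norm_num) (by exact_mod_cast hM i)
  have h4 := mul_le_mul_of_nonneg_right h3 hL
  rw [entropy_congr _ (A := fun z => (D z, fun t => z.2 t i)) (B := fun z => (fun t => z.2 t i, D z))
      (by intro z z'; simp only [Prod.mk.injEq]; tauto),
    entropy_congr _ (A := fun z => (z.1 i, D z, fun t => z.2 t i))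
      (B := fun z => (fun t => z.2 t i, z.1 i, D z))
      (by intro z z'; simp only [Prod.mk.injEq]; tauto)] at h1
  linarith

theorem entropy_outputs_messages (W : DMIC X Y) (c : DMICCode X Y n M) (i j : Fin 3) :
    entropy (W.codeLaw c) (fun z => (fun t => z.2 t j, z.1 i, z.1 (i + 1), z.1 (i + 2)))
        - entropy (W.codeLaw c) (fun z => (z.1 i, z.1 (i + 1), z.1 (i + 2)))
      = ∑ t, W.outputNoise c t j := by
  have := entropy_state_outputs (π := fun _ : ∀ i, Fin (M i) => (∏ i, (M i : ℝ))⁻¹)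
    (k := fun w t => W.trans (c.input w t))
    (fun _ => by positivity) (fun _ _ => (W.trans_mem _).1) (fun _ _ => (W.trans_mem _).2)
    (fun y : ∀ i, Y i => y j)
  rw [entropy_congr _ (A := fun z : (∀ i, Fin (M i)) × (Fin n → ∀ i, Y i) => z.1)
      (B := fun z => (z.1 i, z.1 (i + 1), z.1 (i + 2)))
      (by intro z z'; rw [funext_fin_three_iff i, Prod.mk.injEq, Prod.mk.injEq]),
    entropy_congr _ (A := fun z : (∀ i, Fin (M i)) × (Fin n → ∀ i, Y i) => (fun t => z.2 t j, z.1))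
      (B := fun z => (fun t => z.2 t j, z.1 i, z.1 (i + 1), z.1 (i + 2)))
      (by intro z z'; simp only [Prod.mk.injEq]; rw [funext_fin_three_iff i])] at this
  exact sub_eq_of_eq_add' this

/-- Both single-letter bounds carry the same noise term as the block bounds, so only the positive
output entropies remain to be compared. -/
theorem rateBound_inputLaw (W : DMIC X Y) (c : DMICCode X Y n M) (t : Fin n) (i : Fin 3) :
    W.rateBound (c.inputLaw t) i =
      (entropy (W.codeLaw c) (fun z => (z.2 t i, c.input z.1 t (i + 1), c.input z.1 t (i + 2)))
        - entropy (W.codeLaw c) (fun z => (c.input z.1 t (i + 1), c.input z.1 t (i + 2)))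
        - W.outputNoise c t i,
      entropy (W.codeLaw c) (fun z => (z.2 t i, c.input z.1 t (i + 2)))
        - entropy (W.codeLaw c) (fun z => c.input z.1 t (i + 2)) - W.outputNoise c t i) := by
  have hμ := W.codeLaw_nonneg c
  have h := W.entropy_output_state c t i (fun z => c.input z.1 t) (fun _ _ _ => rfl)
    (fun _ _ h => h)
  rw [rateBound, ← W.law_codeLaw_input_output c t, condMutualInfo_eq_entropy (law_nonneg hμ _),
    condMutualInfo_eq_entropy (law_nonneg hμ _)]
  simp only [entropy_law]
  rw [entropy_congr (W.codeLaw c)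
      (A := fun z => (c.input z.1 t i, c.input z.1 t (i + 1), c.input z.1 t (i + 2)))
      (B := fun z => c.input z.1 t) (by intro z z'; rw [funext_fin_three_iff i]; simp only [Prod.mk.injEq]),
    entropy_congr (W.codeLaw c)
      (A := fun z => ((c.input z.1 t i, c.input z.1 t (i + 1)), c.input z.1 t (i + 2)))
      (B := fun z => c.input z.1 t) (by intro z z'; rw [funext_fin_three_iff i]; simp only [Prod.mk.injEq]; tauto),
    entropy_congr (W.codeLaw c)
      (A := fun z => (c.input z.1 t i, z.2 t i, c.input z.1 t (i + 1), c.input z.1 t (i + 2)))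
      (B := fun z => (z.2 t i, c.input z.1 t))
      (by intro z z'; simp only [Prod.mk.injEq]; rw [funext_fin_three_iff i (c.input z.1 t)]; tauto),
    entropy_congr (W.codeLaw c)
      (A := fun z => ((c.input z.1 t i, c.input z.1 t (i + 1)), z.2 t i, c.input z.1 t (i + 2)))
      (B := fun z => (z.2 t i, c.input z.1 t))
      (by intro z z'; simp only [Prod.mk.injEq]; rw [funext_fin_three_iff i (c.input z.1 t)]; tauto), h]
  refine Prod.ext ?_ ?_ <;> simp only <;> ring

/-- Single-user bound before single-letterization. -/
theorem logb_card_le_entropy (W : DMIC X Y) (c : DMICCode X Y n M) (hM : ∀ i, 0 < M i)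
    (i : Fin 3) :
    (1 - W.errorProb c) * Real.logb 2 (M i) ≤ 1
      + (entropy (W.codeLaw c) (fun z => (fun t => z.2 t i, z.1 (i + 1), z.1 (i + 2)))
      - entropy (W.codeLaw c) (fun z => (z.1 (i + 1), z.1 (i + 2))) - ∑ t, W.outputNoise c t i) := by
  have := W.logb_card_le_add_errorProb c hM i _ (W.logb_card_le_of_two c hM i)
  rw [W.entropy_outputs_messages] at this
  linarith

theorem logb_card_le_sum_rateBound (W : DMIC X Y) (c : DMICCode X Y n M) (hM : ∀ i, 0 < M i)
    (i : Fin 3) :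
    (1 - W.errorProb c) * Real.logb 2 (M i) ≤ 1 + ∑ t, (W.rateBound (c.inputLaw t) i).1 := by
  have h1 := W.logb_card_le_entropy c hM i
  have h2 := entropy_seq_le (W.codeLaw_nonneg c) (fun z t => z.2 t i)
    (fun z => (z.1 (i + 1), z.1 (i + 2)))
    (fun t z => (c.input z.1 t (i + 1), c.input z.1 t (i + 2)))
    (fun t z z' h => by
      simp only [Prod.mk.injEq] at h
      simp only [DMICCode.input, h.1, h.2])
  simp only [rateBound_inputLaw, Finset.sum_sub_distrib] at h2 ⊢
  linarith

/-- Fano for user `i` with genie `W (i + 2)` leaves minus the entropy of the block at receiver `i`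
given `W i` and `W (i + 2)`. Fano for user `i + 1` with genie `(W (i + 2), W i)` gives a block
entropy at receiver `i + 1`, which strong interference moves to receiver `i`, where it cancels that
term. The `2` is one bit from each use of Fano. -/
theorem logb_card_add_le_sum_rateBound (W : DMIC X Y) (hs : W.CyclicStrong)
    (c : DMICCode X Y n M) (hM : ∀ i, 0 < M i) (i : Fin 3) :
    (1 - W.errorProb c) * (Real.logb 2 (M i) + Real.logb 2 (M (i + 1)))
      ≤ 2 + ∑ t, (W.rateBound (c.inputLaw t) i).2 := by
  have e1 : i + 1 + 1 = i + 2 := by decide +revert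
  have e2 : i + 1 + 2 = i := by decide +revert
  have h0 := W.logb_card_le_add_errorProb c hM i _ (W.logb_card_le_of_one c hM i)
  have h1 := W.logb_card_le_entropy c hM (i + 1)
  have h2 := entropy_seq_le (W.codeLaw_nonneg c) (fun z t => z.2 t i)
    (fun z => z.1 (i + 2)) (fun t z => c.input z.1 t (i + 2))
    (fun t z z' h => by simp only [DMICCode.input, h])
  have h3 := W.entropy_outputs_strong_le hs c hM (i + 1)
  rw [e1, e2] at h1 h3
  rw [entropy_congr (W.codeLaw c) (A := fun z => (z.1 i, z.1 (i + 2)))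
      (B := fun z => (z.1 (i + 2), z.1 i)) (by intro z z'; simp only [Prod.mk.injEq]; tauto),
    entropy_congr (W.codeLaw c) (A := fun z => (fun t => z.2 t i, z.1 i, z.1 (i + 2)))
      (B := fun z => (fun t => z.2 t i, z.1 (i + 2), z.1 i))
      (by intro z z'; simp only [Prod.mk.injEq]; tauto)] at h0
  simp only [rateBound_inputLaw, Finset.sum_sub_distrib] at h2 ⊢
  linarith

/-- The converse: achievable rates obey the bounds. -/
theorem Achievable.exists_mem_rateBoundHull (W : DMIC X Y) (hs : W.CyclicStrong) {R : Fin 3 → ℝ}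
    (hR : W.Achievable R) : ∃ v ∈ W.rateBoundHull, (fun i => (R i, R i + R (i + 1))) ≤ v := by
  obtain ⟨hR0, c, hc⟩ := hR
  let e : ℕ → ℝ := fun n => W.errorProb (c n)
  -- Fano's loss is at most two bits per block, hence `2 / n` per channel use. The corrected vectors
  -- lie in a closed set and tend to the rate vector.
  have hlim1 : ∀ r : ℝ, Filter.Tendsto (fun n : ℕ => (1 - e n) * r - 2 * (n : ℝ)⁻¹) Filter.atTop
      (𝓝 r) := by
    intro r
    have := ((tendsto_const_nhds (x := (1 : ℝ))).sub hc).mul_const r |>.sub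
      ((tendsto_inv_atTop_nhds_zero_nat (𝕜 := ℝ)).const_mul 2)
    simpa using this
  have hlim : Filter.Tendsto (fun (n : ℕ) (i : Fin 3) => ((1 - e n) * R i - 2 * (n : ℝ)⁻¹,
      (1 - e n) * (R i + R (i + 1)) - 2 * (n : ℝ)⁻¹)) Filter.atTop
      (𝓝 fun i => (R i, R i + R (i + 1))) :=
    tendsto_pi_nhds.2 fun i => (hlim1 _).prodMk_nhds (hlim1 _)
  refine W.isClosed_lowerClosure_rateBoundHull.mem_of_tendsto hlim ?_
  have hev : ∀ᶠ n in Filter.atTop, e n < 1 := hc.eventually_lt_const one_pos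
  filter_upwards [hev, Filter.eventually_gt_atTop 0] with n hen hn
  have hn' : (0 : ℝ) < n := Nat.cast_pos.2 hn
  have hM : ∀ i, 0 < ⌈(2 : ℝ) ^ ((n : ℝ) * R i)⌉₊ := fun i => Nat.ceil_pos.2 (by positivity)
  have hL : ∀ i, n * R i ≤ Real.logb 2 (⌈(2 : ℝ) ^ ((n : ℝ) * R i)⌉₊) := fun i => by
    rw [Real.le_logb_iff_rpow_le (by norm_num) (by exact_mod_cast hM i)]
    exact Nat.le_ceil _
  -- The time-sharing variable is uniform over the `n` channel uses.
  refine ⟨∑ t : Fin n, (n : ℝ)⁻¹ • W.rateBound ((c n).inputLaw t), ?_, fun i => ⟨?_, ?_⟩⟩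
  · refine (convex_convexHull ℝ _).sum_mem (fun _ _ => by positivity) ?_ fun t _ =>
      subset_convexHull ℝ _ ⟨_, fun i _ => (c n).inputLaw_mem hM t i, rfl⟩
    simp [hn'.ne']
  · have h := W.logb_card_le_sum_rateBound (c n) hM i
    have h2 := mul_le_mul_of_nonneg_left (hL i) (sub_nonneg.2 hen.le)
    simp only [Finset.sum_apply, Pi.smul_apply, Prod.fst_sum, Prod.smul_fst, smul_eq_mul,
      ← Finset.mul_sum]
    rw [sub_le_iff_le_add, mul_comm 2, ← mul_add, inv_mul_eq_div, le_div_iff₀ hn']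
    simp only [e] at h2 ⊢
    linarith
  · have h := W.logb_card_add_le_sum_rateBound hs (c n) hM i
    have h2 := mul_le_mul_of_nonneg_left (add_le_add (hL i) (hL (i + 1))) (sub_nonneg.2 hen.le)
    simp only [Finset.sum_apply, Pi.smul_apply, Prod.snd_sum, Prod.smul_snd, smul_eq_mul,
      ← Finset.mul_sum]
    rw [sub_le_iff_le_add, mul_comm 2, ← mul_add, inv_mul_eq_div, le_div_iff₀ hn']
    simp only [e] at h2 ⊢
    linarith

end DMIC

/-! ### Product laws and averaged kernels -/

namespace InfoTheory

section Product

variable {ι : Type*} [Fintype ι] [DecidableEq ι] {α β : ι → Type*} [∀ i, Fintype (α i)]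

/-- Independent random variables have a product law. -/
theorem law_pi (P : ∀ i, α i → ℝ) (φ : ∀ i, α i → β i) (b : ∀ i, β i) :
    law (fun x : ∀ i, α i => ∏ i, P i (x i)) (fun x i => φ i (x i)) b
      = ∏ i, law (P i) (φ i) (b i) := by
  classical
  simp only [law]
  rw [Fintype.prod_sum]
  refine Finset.sum_congr rfl fun x _ => ?_
  by_cases h : (fun i => φ i (x i)) = b
  · rw [if_pos h]
    exact Finset.prod_congr rfl fun i _ => (if_pos (congrFun h i)).symm
  · rw [if_neg h]
    obtain ⟨i, hi⟩ := Function.ne_iff.1 h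
    exact (Finset.prod_eq_zero (Finset.mem_univ i) (if_neg hi)).symm

theorem sum_pi_mul_comp [∀ i, Fintype (β i)] (P : ∀ i, α i → ℝ) (φ : ∀ i, α i → β i) (F : (∀ i, β i) → ℝ) :
    ∑ x : ∀ i, α i, (∏ i, P i (x i)) * F (fun i => φ i (x i))
      = ∑ b, (∏ i, law (P i) (φ i) (b i)) * F b := by
  rw [← sum_law_mul (fun x : ∀ i, α i => ∏ i, P i (x i)) (fun x i => φ i (x i)) F]
  simp only [law_pi]

/-- Resampling the coordinates in `S` does not change expectations under a product law. -/
theorem sum_prod_mul_piecewise {p : ∀ i, α i → ℝ} (hp : ∀ i, ∑ a, p i a = 1) (S : Finset ι)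
    (f : (∀ i, α i) → ℝ) :
    ∑ x, (∏ i, p i (x i)) * f x
      = ∑ x, (∏ i, p i (x i)) * ∑ z, (∏ i, p i (z i)) * f (S.piecewise z x) := by
  -- Two independent copies exchange their coordinates in `S`, an involution preserving the weight.
  let e : (∀ i, α i) × (∀ i, α i) ≃ (∀ i, α i) × (∀ i, α i) :=
    { toFun := fun s => (S.piecewise s.2 s.1, S.piecewise s.1 s.2)
      invFun := fun s => (S.piecewise s.2 s.1, S.piecewise s.1 s.2)
      left_inv := fun s => by ext i <;> by_cases h : i ∈ S <;> simp [h]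
      right_inv := fun s => by ext i <;> by_cases h : i ∈ S <;> simp [h] }
  have h1 : ∑ x, (∏ i, p i (x i)) * f x
      = ∑ s : (∀ i, α i) × (∀ i, α i), (∏ i, p i (s.1 i) * p i (s.2 i)) * f s.1 := by
    rw [Fintype.sum_prod_type]
    refine Finset.sum_congr rfl fun x _ => ?_
    simp only [Finset.prod_mul_distrib, mul_right_comm _ (∏ i, p i _) (f x), ← Finset.mul_sum]
    rw [← Fintype.prod_sum (fun i a => p i a)]
    simp [hp]
  rw [h1, ← e.sum_comp, Fintype.sum_prod_type]
  refine Finset.sum_congr rfl fun x _ => ?_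
  rw [Finset.mul_sum]
  refine Finset.sum_congr rfl fun z _ => ?_
  rw [← mul_assoc, ← Finset.prod_mul_distrib]
  congr 1
  refine Finset.prod_congr rfl fun i _ => ?_
  by_cases h : i ∈ S <;> simp [e, h, mul_comm]

/-- The kernel `κ` averaged over the inputs in `S`. -/
def avgKernel {D : Type*} (p : ∀ i, α i → ℝ) (κ : (∀ i, α i) → D → ℝ) (S : Finset ι)
    (x : ∀ i, α i) (d : D) : ℝ :=
  ∑ z, (∏ i, p i (z i)) * κ (S.piecewise z x) d

variable {D : Type*} {p : ∀ i, α i → ℝ} {κ : (∀ i, α i) → D → ℝ}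

theorem avgKernel_nonneg (hp0 : ∀ i a, 0 ≤ p i a) (hκ : ∀ x d, 0 ≤ κ x d) (S : Finset ι)
    (x : ∀ i, α i) (d : D) : 0 ≤ avgKernel p κ S x d :=
  Finset.sum_nonneg fun _ _ => mul_nonneg (Finset.prod_nonneg fun _ _ => hp0 _ _) (hκ _ _)

theorem sum_avgKernel [Fintype D] (hp : ∀ i, ∑ a, p i a = 1) (hκ1 : ∀ x, ∑ d, κ x d = 1)
    (S : Finset ι) (x : ∀ i, α i) : ∑ d, avgKernel p κ S x d = 1 := by
  simp only [avgKernel]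
  rw [Finset.sum_comm]
  simp only [← Finset.mul_sum, hκ1, mul_one]
  rw [← Fintype.prod_sum (fun i a => p i a)]
  simp [hp]

theorem avgKernel_congr {S : Finset ι} {x x' : ∀ i, α i} (h : ∀ i ∉ S, x i = x' i) (d : D) :
    avgKernel p κ S x d = avgKernel p κ S x' d := by
  unfold avgKernel
  refine Finset.sum_congr rfl fun z _ => ?_
  congr 2
  ext i
  by_cases hi : i ∈ S <;> simp [hi, h]

/-- An average over `S ∪ T` is unchanged when its sample is first resampled on `T`; the fresh
coordinates form the inner average. -/
theorem avgKernel_avgKernel (hp : ∀ i, ∑ a, p i a = 1) (S T : Finset ι) (x : ∀ i, α i) (d : D) :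
    avgKernel p (avgKernel p κ T) S x d = avgKernel p κ (S ∪ T) x d := by
  unfold avgKernel
  rw [sum_prod_mul_piecewise hp T fun z => κ ((S ∪ T).piecewise z x) d]
  refine Finset.sum_congr rfl fun z _ => ?_
  congr 1
  refine Finset.sum_congr rfl fun z' _ => ?_
  congr 2
  ext i
  by_cases hi : i ∈ T <;> by_cases hi' : i ∈ S <;> simp [hi, hi']

end Product

/-! ### Random codebooks -/

section Codebook

variable {ι : Type*} [Fintype ι] {α : ι → Type*} {M : ι → ℕ}

/-- The probability of a codebook whose codewords are drawn independently. -/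
def codebookWeight (p : ∀ i, α i → ℝ) (C : ∀ i, Fin (M i) → α i) : ℝ := ∏ i, ∏ m, p i (C i m)

theorem codebookWeight_nonneg {p : ∀ i, α i → ℝ} (hp0 : ∀ i a, 0 ≤ p i a)
    (C : ∀ i, Fin (M i) → α i) : 0 ≤ codebookWeight p C :=
  Finset.prod_nonneg fun _ _ => Finset.prod_nonneg fun _ _ => hp0 _ _

variable [DecidableEq ι] [∀ i, Fintype (α i)]

theorem sum_codebookWeight {p : ∀ i, α i → ℝ} (hp : ∀ i, ∑ a, p i a = 1) :
    ∑ C : ∀ i, Fin (M i) → α i, codebookWeight p C = 1 := by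
  simp only [codebookWeight]
  rw [← Fintype.prod_sum fun i (c : Fin (M i) → α i) => ∏ m, p i (c m)]
  refine Finset.prod_eq_one fun i _ => ?_
  rw [← Fintype.prod_sum fun (_ : Fin (M i)) a => p i a]
  simp [hp]

/-- Equal indices give the same codeword and distinct ones give independent codewords; one formula
on pairs serves both cases, so it can be applied user by user. -/
theorem law_two_codewords {A : Type*} [Fintype A] {q : A → ℝ} (hq : ∑ a, q a = 1) {m : ℕ}
    (u v : Fin m) :
    law (fun c : Fin m → A => ∏ t, q (c t)) (fun c => (c u, c v))
      = law (fun s : A × A => q s.1 * q s.2) (fun s => (if u = v then s.1 else s.2, s.1)) := by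
  classical
  funext b
  have h : ∀ f : (Fin m → A) → ℝ, ∀ j, ∑ c, (∏ t, q (c t)) * f c
      = ∑ c, (∏ t, q (c t)) * ∑ a, q a * f (Function.update c j a) := fun f j =>
    sum_prod_mul_update (p := fun _ => q) hq f
  have h1 : ∑ c : Fin m → A, ∏ t, q (c t) = 1 := by
    rw [← Fintype.prod_sum fun (_ : Fin m) a => q a]
    simp [hq]
  have key : ∑ c : Fin m → A, (∏ t, q (c t)) * (if (c u, c v) = b then 1 else 0)
      = ∑ s : A × A, q s.1 * q s.2 * (if (if u = v then s.1 else s.2, s.1) = b then 1 else 0) := by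
    rw [h _ v]
    by_cases huv : u = v
    · subst huv
      simp only [Function.update_self, if_true]
      rw [← Finset.sum_mul, h1, one_mul, Fintype.sum_prod_type]
      refine Finset.sum_congr rfl fun a _ => ?_
      by_cases hb : (a, a) = b <;> simp [hb, ← Finset.mul_sum, hq]
    · simp only [Function.update_self, Function.update_of_ne huv, if_neg huv]
      rw [h _ u]
      simp only [Function.update_self]
      rw [← Finset.sum_mul, h1, one_mul, Fintype.sum_prod_type, Finset.sum_comm]
      refine Finset.sum_congr rfl fun a _ => ?_
      rw [Finset.mul_sum]
      refine Finset.sum_congr rfl fun a' _ => ?_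
      ring
  simpa [law] using key

/-- Expectation of a function of the codewords of two message tuples. -/
theorem sum_codebookWeight_mul {p : ∀ i, α i → ℝ} (hp : ∀ i, ∑ a, p i a = 1)
    (w w' : ∀ i, Fin (M i)) (F : (∀ i, α i) → (∀ i, α i) → ℝ) :
    ∑ C, codebookWeight p C * F (fun i => C i (w i)) (fun i => C i (w' i))
      = ∑ x, (∏ i, p i (x i)) * ∑ z, (∏ i, p i (z i)) *
        F ((Finset.univ.filter fun i => w i ≠ w' i).piecewise z x) x := by
  have h1 := sum_pi_mul_comp (fun i (c : Fin (M i) → α i) => ∏ m, p i (c m))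
    (fun i c => (c (w i), c (w' i))) (fun b => F (fun i => (b i).1) (fun i => (b i).2))
  have h2 := sum_pi_mul_comp (fun i (s : α i × α i) => p i s.1 * p i s.2)
    (fun i s => (if w i = w' i then s.1 else s.2, s.1))
    (fun b => F (fun i => (b i).1) (fun i => (b i).2))
  simp only [fun i => law_two_codewords (hp i) (w i) (w' i)] at h1
  rw [← h2] at h1
  refine h1.trans ?_
  let e : (∀ i, α i) × (∀ i, α i) ≃ (∀ i, α i × α i) :=
    { toFun := fun s i => (s.1 i, s.2 i)
      invFun := fun s => (fun i => (s i).1, fun i => (s i).2)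
      left_inv := fun s => rfl
      right_inv := fun s => rfl }
  rw [← e.sum_comp, Fintype.sum_prod_type]
  refine Finset.sum_congr rfl fun x _ => ?_
  rw [Finset.mul_sum]
  refine Finset.sum_congr rfl fun z _ => ?_
  simp only [e, Equiv.coe_fn_mk, Finset.prod_mul_distrib, mul_assoc]
  congr 4
  ext i
  by_cases h : w i = w' i <;> simp [Finset.piecewise, h]

theorem sum_codebookWeight_mul_self {p : ∀ i, α i → ℝ} (hp : ∀ i, ∑ a, p i a = 1)
    (w : ∀ i, Fin (M i)) (F : (∀ i, α i) → ℝ) :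
    ∑ C, codebookWeight p C * F (fun i => C i (w i)) = ∑ x, (∏ i, p i (x i)) * F x := by
  have := sum_codebookWeight_mul hp w w fun _ x => F x
  rw [this]
  refine Finset.sum_congr rfl fun x _ => ?_
  rw [← Finset.sum_mul, ← Fintype.prod_sum (fun i a => p i a)]
  simp [hp]

open Classical in
/-- The probability that the wrong message tuple `w'` passes the likelihood test that compares
`avgKernel p κ I` with `avgKernel p κ (I ∪ J)`, where `J` is the set of users for which the
messages differ. -/
theorem sum_codebookWeight_mul_pass_le {D : Type*} [Fintype D] {p : ∀ i, α i → ℝ}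
    {κ : (∀ i, α i) → D → ℝ} (hp0 : ∀ i a, 0 ≤ p i a) (hp : ∀ i, ∑ a, p i a = 1)
    (hκ : ∀ x d, 0 ≤ κ x d) (hκ1 : ∀ x, ∑ d, κ x d = 1) (w w' : ∀ i, Fin (M i))
    (I J : Finset ι) (hJ : ∀ i, i ∈ J ↔ w i ≠ w' i) {Γ : ℝ} (hΓ : 0 < Γ) :
    ∑ C, codebookWeight p C * ∑ d, κ (fun i => C i (w i)) d *
      (if Γ * avgKernel p κ (I ∪ J) (fun i => C i (w' i)) d
        < avgKernel p κ I (fun i => C i (w' i)) d then 1 else 0) ≤ Γ⁻¹ := by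
  set T : (∀ i, α i) → D → ℝ := fun x d =>
    if Γ * avgKernel p κ (I ∪ J) x d < avgKernel p κ I x d then 1 else 0 with hT
  have hTI : ∀ z x d, T (I.piecewise z x) d = T x d := by
    intro z x d
    simp only [hT]
    rw [avgKernel_congr (S := I) (x := I.piecewise z x) (x' := x) (fun i hi => by simp [hi]),
      avgKernel_congr (S := I ∪ J) (x := I.piecewise z x) (x' := x) (fun i hi => by
        simp [show i ∉ I from fun h => hi (Finset.mem_union_left _ h)])]
  have hJ' : (Finset.univ.filter fun i => w i ≠ w' i) = J := by ext i; simp [hJ]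
  -- Given the codewords `x` of `w'`, the transmitted ones agree with `x` off `J` and are fresh on
  -- `J`, so the output has law `avgKernel p κ J x`.
  have e1 := sum_codebookWeight_mul hp w w' fun x x' => ∑ d, κ x d * T x' d
  rw [hJ'] at e1
  refine (le_of_eq e1).trans ?_
  have e2 : ∀ x, ∑ z, (∏ i, p i (z i)) * ∑ d, κ (J.piecewise z x) d * T x d
      = ∑ d, avgKernel p κ J x d * T x d := by
    intro x
    simp only [avgKernel, Finset.sum_mul, Finset.mul_sum]
    rw [Finset.sum_comm]
    simp only [mul_assoc]
  simp only [e2]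
  -- The test does not see the coordinates in `I`, so these may be averaged out of the output law
  -- too.
  rw [sum_prod_mul_piecewise hp I]
  have e3 : ∀ x, ∑ z, (∏ i, p i (z i)) *
      ∑ d, avgKernel p κ J (I.piecewise z x) d * T (I.piecewise z x) d
      = ∑ d, avgKernel p κ (I ∪ J) x d * T x d := by
    intro x
    simp only [← avgKernel_avgKernel (κ := κ) hp I J, hTI]
    change _ = ∑ d, (∑ z, (∏ i, p i (z i)) * avgKernel p κ J (I.piecewise z x) d) * T x d
    simp only [Finset.sum_mul, Finset.mul_sum]
    rw [Finset.sum_comm]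
    simp only [mul_assoc]
  simp only [e3]
  -- Change of measure: where the test passes, the output law is below `Γ⁻¹` times a probability.
  have e4 : ∀ x, ∑ d, avgKernel p κ (I ∪ J) x d * T x d ≤ Γ⁻¹ := by
    intro x
    calc ∑ d, avgKernel p κ (I ∪ J) x d * T x d ≤ ∑ d, Γ⁻¹ * avgKernel p κ I x d := by
          refine Finset.sum_le_sum fun d _ => ?_
          by_cases h : Γ * avgKernel p κ (I ∪ J) x d < avgKernel p κ I x d
          · simp only [hT, h, if_true, mul_one]
            rw [le_inv_mul_iff₀ hΓ]
            exact h.le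
          · simp only [hT, h, if_false, mul_zero]
            exact mul_nonneg (inv_nonneg.2 hΓ.le) (avgKernel_nonneg hp0 hκ _ _ _)
      _ = Γ⁻¹ := by rw [← Finset.mul_sum, sum_avgKernel hp hκ1, mul_one]
  calc ∑ x, (∏ i, p i (x i)) * ∑ d, avgKernel p κ (I ∪ J) x d * T x d
      ≤ ∑ x : ∀ i, α i, (∏ i, p i (x i)) * Γ⁻¹ := Finset.sum_le_sum fun x _ =>
        mul_le_mul_of_nonneg_left (e4 x) (Finset.prod_nonneg fun _ _ => hp0 _ _)
    _ = Γ⁻¹ := by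
      rw [← Finset.sum_mul, ← Fintype.prod_sum (fun i a => p i a)]
      simp [hp]

end Codebook

end InfoTheory

/-! ### The tests of a receiver -/

namespace InfoTheory

section Receiver

variable {α : Fin 3 → Type*} [∀ i, Fintype (α i)] {M : Fin 3 → ℕ} {D : Type*}

/-- The likelihood tests of receiver `i` for a triple of codewords: user `i + 2` is tested
while treating the other users as noise, and users `i` and `i + 1` are tested given the others. -/
def PassesTests (p : ∀ i, α i → ℝ) (κ : (∀ i, α i) → D → ℝ) (Γ : Fin 3 → ℝ) (i : Fin 3)
    (x : ∀ i, α i) (d : D) : Prop :=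
  Γ 0 * avgKernel p κ ({i, i + 1} ∪ {i + 2}) x d < avgKernel p κ {i, i + 1} x d ∧
  Γ 1 * avgKernel p κ (∅ ∪ {i}) x d < avgKernel p κ ∅ x d ∧
  Γ 2 * avgKernel p κ (∅ ∪ {i, i + 1}) x d < avgKernel p κ ∅ x d

variable {p : ∀ i, α i → ℝ} {κ : (∀ i, α i) → D → ℝ}

-- A union bound by the pattern of errors. A wrong message of user `i + 2` is caught by the first
-- test alone. Otherwise `w'` differs from `w` in user `i` only, or in users `i` and `i + 1`. Since
-- `w' i ≠ w i`, an error in user `i + 1` alone never has to be counted.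
open Classical in
theorem passesTests_wrong_le (Γ : Fin 3 → ℝ) (i : Fin 3)
    (w : ∀ i, Fin (M i)) (C : ∀ i, Fin (M i) → α i) (d : D) :
    (if ¬ PassesTests p κ Γ i (fun l => C l (w l)) d ∨
        ∃ w' : ∀ i, Fin (M i), PassesTests p κ Γ i (fun l => C l (w' l)) d ∧ w' i ≠ w i
      then (1 : ℝ) else 0) ≤
    (if ¬ PassesTests p κ Γ i (fun l => C l (w l)) d then 1 else 0)
    + ∑ m ∈ Finset.univ.erase (w (i + 2)),
      (if Γ 0 * avgKernel p κ ({i, i + 1} ∪ {i + 2})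
          (fun l => C l (Function.update w (i + 2) m l)) d
        < avgKernel p κ {i, i + 1} (fun l => C l (Function.update w (i + 2) m l)) d then 1 else 0)
    + ∑ m ∈ Finset.univ.erase (w i),
      (if Γ 1 * avgKernel p κ (∅ ∪ {i}) (fun l => C l (Function.update w i m l)) d
        < avgKernel p κ ∅ (fun l => C l (Function.update w i m l)) d then 1 else 0)
    + ∑ m ∈ Finset.univ.erase (w i), ∑ m' ∈ Finset.univ.erase (w (i + 1)),
      (if Γ 2 * avgKernel p κ (∅ ∪ {i, i + 1})
          (fun l => C l (Function.update (Function.update w i m) (i + 1) m' l)) d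
        < avgKernel p κ ∅
          (fun l => C l (Function.update (Function.update w i m) (i + 1) m' l)) d then 1 else 0) := by
  have nn : ∀ P : Prop, (0 : ℝ) ≤ if P then 1 else 0 := fun P => by split_ifs <;> norm_num
  have n1 : ∀ {κ : Type} (s : Finset κ) (P : κ → Prop), (0 : ℝ) ≤ ∑ m ∈ s, if P m then 1 else 0 :=
    fun s P => Finset.sum_nonneg fun m _ => nn _
  have n2 : ∀ {κ κ' : Type} (s : Finset κ) (s' : Finset κ') (P : κ → κ' → Prop),
      (0 : ℝ) ≤ ∑ m ∈ s, ∑ m' ∈ s', if P m m' then 1 else 0 :=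
    fun s s' P => Finset.sum_nonneg fun m _ => Finset.sum_nonneg fun m' _ => nn _
  have one_le : ∀ {κ : Type} (s : Finset κ) (P : κ → Prop) (m : κ), m ∈ s → P m →
      (1 : ℝ) ≤ ∑ m ∈ s, if P m then 1 else 0 := fun s P m hm hP => by
    refine le_trans ?_ (Finset.single_le_sum (fun m _ => nn (P m)) hm)
    rw [if_pos hP]
  have h3i := i.eq_or_eq_add_one_or_eq_add_two
  have d1 := i.add_one_ne_self_of_three
  have d2 := i.add_two_ne_self_of_three
  have d3 : i + 2 ≠ i + 1 := by clear * -; decide +revert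
  have N1 := n1 (Finset.univ.erase (w (i + 2))) fun m => Γ 0 * avgKernel p κ ({i, i + 1} ∪ {i + 2})
    (fun l => C l (Function.update w (i + 2) m l)) d
    < avgKernel p κ {i, i + 1} (fun l => C l (Function.update w (i + 2) m l)) d
  have N2 := n1 (Finset.univ.erase (w i)) fun m => Γ 1 * avgKernel p κ (∅ ∪ {i})
    (fun l => C l (Function.update w i m l)) d
    < avgKernel p κ ∅ (fun l => C l (Function.update w i m l)) d
  have N3 := n2 (Finset.univ.erase (w i)) (Finset.univ.erase (w (i + 1))) fun m m' =>
    Γ 2 * avgKernel p κ (∅ ∪ {i, i + 1})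
      (fun l => C l (Function.update (Function.update w i m) (i + 1) m' l)) d
    < avgKernel p κ ∅ (fun l => C l (Function.update (Function.update w i m) (i + 1) m' l)) d
  by_cases hpass : ¬ PassesTests p κ Γ i (fun l => C l (w l)) d
  · rw [if_pos (Or.inl hpass), if_pos hpass]
    linarith
  rw [if_neg hpass]
  by_cases hex : ∃ w' : ∀ i, Fin (M i), PassesTests p κ Γ i (fun l => C l (w' l)) d ∧ w' i ≠ w i
  swap
  · rw [if_neg (not_or.2 ⟨hpass, hex⟩)]
    linarith
  rw [if_pos (Or.inr hex)]
  obtain ⟨w', ⟨h1, h2, h3⟩, hne⟩ := hex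
  by_cases hk : w' (i + 2) = w (i + 2)
  · by_cases hj : w' (i + 1) = w (i + 1)
    · have e : Function.update w i (w' i) = w' := by
        funext l
        rcases h3i l with rfl | rfl | rfl
        · simp
        · rw [Function.update_of_ne d1, hj]
        · rw [Function.update_of_ne d2, hk]
      have := one_le (Finset.univ.erase (w i)) (fun m => Γ 1 * avgKernel p κ (∅ ∪ {i})
        (fun l => C l (Function.update w i m l)) d
        < avgKernel p κ ∅ (fun l => C l (Function.update w i m l)) d) (w' i) (by simp [hne])
        (by rw [e]; exact h2)
      linarith
    · have e : Function.update (Function.update w i (w' i)) (i + 1) (w' (i + 1)) = w' := by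
        funext l
        rcases h3i l with rfl | rfl | rfl
        · rw [Function.update_of_ne d1.symm, Function.update_self]
        · simp
        · rw [Function.update_of_ne d3, Function.update_of_ne d2, hk]
      have h4 := one_le (Finset.univ.erase (w (i + 1))) (fun m' =>
        Γ 2 * avgKernel p κ (∅ ∪ {i, i + 1})
          (fun l => C l (Function.update (Function.update w i (w' i)) (i + 1) m' l)) d
        < avgKernel p κ ∅
          (fun l => C l (Function.update (Function.update w i (w' i)) (i + 1) m' l)) d)
        (w' (i + 1)) (by simp [hj]) (by rw [e]; exact h3)
      have h5 := h4.trans (Finset.single_le_sum (f := fun m => ∑ m' ∈ Finset.univ.erase (w (i + 1)),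
        if Γ 2 * avgKernel p κ (∅ ∪ {i, i + 1})
          (fun l => C l (Function.update (Function.update w i m) (i + 1) m' l)) d
        < avgKernel p κ ∅
          (fun l => C l (Function.update (Function.update w i m) (i + 1) m' l)) d
        then (1 : ℝ) else 0) (fun m _ => n1 _ _)
        (show w' i ∈ Finset.univ.erase (w i) by simp [hne]))
      linarith
  -- The first test averages over users `i` and `i + 1`, so it does not notice that their messages
  -- are reset to the true ones. This leaves one event per wrong message of user `i + 2` instead of
  -- one per triple.
  · have := one_le (Finset.univ.erase (w (i + 2))) (fun m =>
      Γ 0 * avgKernel p κ ({i, i + 1} ∪ {i + 2}) (fun l => C l (Function.update w (i + 2) m l)) d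
      < avgKernel p κ {i, i + 1} (fun l => C l (Function.update w (i + 2) m l)) d) (w' (i + 2))
      (by simp [hk]) (by
        rw [avgKernel_congr (S := {i, i + 1} ∪ {i + 2}) (x' := fun l => C l (w' l)) (fun l hl => by
            have := h3i l
            simp only [Finset.mem_union, Finset.mem_insert, Finset.mem_singleton] at hl
            tauto),
          avgKernel_congr (S := {i, i + 1}) (x' := fun l => C l (w' l)) (fun l hl => by
            have := h3i l
            simp only [Finset.mem_insert, Finset.mem_singleton] at hl
            obtain rfl : l = i + 2 := by tauto
            rw [Function.update_self])]
        exact h1)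
    linarith

theorem sum_erase_const {m : ℕ} (a : Fin m) (r : ℝ) :
    ∑ _m ∈ Finset.univ.erase a, r = (m - 1 : ℝ) * r := by
  rw [Finset.sum_const, Finset.card_erase_of_mem (Finset.mem_univ a), Finset.card_fin,
    nsmul_eq_mul, Nat.cast_pred a.pos]

open Classical in
/-- Error probability of receiver `i`, averaged over the codebooks. -/
theorem sum_codebookWeight_mul_error_le [Fintype D] (hp0 : ∀ i a, 0 ≤ p i a)
    (hp : ∀ i, ∑ a, p i a = 1) (hκ : ∀ x d, 0 ≤ κ x d) (hκ1 : ∀ x, ∑ d, κ x d = 1)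
    {Γ : Fin 3 → ℝ} (hΓ : ∀ j, 0 < Γ j) (i : Fin 3) (w : ∀ i, Fin (M i)) :
    ∑ C, codebookWeight p C * ∑ d, κ (fun l => C l (w l)) d *
      (if ¬ PassesTests p κ Γ i (fun l => C l (w l)) d ∨
        ∃ w' : ∀ i, Fin (M i), PassesTests p κ Γ i (fun l => C l (w' l)) d ∧ w' i ≠ w i
      then (1 : ℝ) else 0) ≤
    ∑ x, (∏ i, p i (x i)) * ∑ d, κ x d * (if ¬ PassesTests p κ Γ i x d then 1 else 0)
    + (M (i + 2) - 1) * (Γ 0)⁻¹ + (M i - 1) * (Γ 1)⁻¹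
    + (M i - 1) * ((M (i + 1) - 1) * (Γ 2)⁻¹) := by
  have d1 := i.add_one_ne_self_of_three
  rw [← sum_codebookWeight_mul_self hp w
    fun x => ∑ d, κ x d * (if ¬ PassesTests p κ Γ i x d then (1 : ℝ) else 0)]
  have step : ∀ C : ∀ i, Fin (M i) → α i, codebookWeight p C * ∑ d, κ (fun l => C l (w l)) d * _ ≤
      codebookWeight p C * ∑ d, κ (fun l => C l (w l)) d * _ := fun C =>
    mul_le_mul_of_nonneg_left (Finset.sum_le_sum fun d _ =>
      mul_le_mul_of_nonneg_left (passesTests_wrong_le (p := p) (κ := κ) Γ i w C d) (hκ _ _))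
      (codebookWeight_nonneg hp0 C)
  refine (Finset.sum_le_sum fun C _ => step C).trans ?_
  simp only [mul_add, Finset.sum_add_distrib]
  refine add_le_add (add_le_add (add_le_add le_rfl ?_) ?_) ?_
  · rw [← sum_erase_const (w (i + 2))]
    simp only [Finset.mul_sum]
    simp only [Finset.sum_comm (t := Finset.univ.erase (w (i + 2)))]
    refine Finset.sum_le_sum fun m hm => ?_
    simp only [← Finset.mul_sum]
    refine sum_codebookWeight_mul_pass_le hp0 hp hκ hκ1 w (Function.update w (i + 2) m)
      {i, i + 1} {i + 2} (fun l => ?_) (hΓ 0)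
    by_cases hl : l = i + 2
    · subst hl
      simpa [eq_comm] using hm
    · simp [hl]
  · rw [← sum_erase_const (w i)]
    simp only [Finset.mul_sum]
    simp only [Finset.sum_comm (t := Finset.univ.erase (w i))]
    refine Finset.sum_le_sum fun m hm => ?_
    simp only [← Finset.mul_sum]
    refine sum_codebookWeight_mul_pass_le hp0 hp hκ hκ1 w (Function.update w i m)
      ∅ {i} (fun l => ?_) (hΓ 1)
    by_cases hl : l = i
    · subst hl
      simpa [eq_comm] using hm
    · simp [hl]
  · rw [← sum_erase_const (w i)]
    simp only [Finset.mul_sum]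
    simp only [Finset.sum_comm (t := Finset.univ.erase (w i))]
    refine Finset.sum_le_sum fun m hm => ?_
    rw [← sum_erase_const (w (i + 1))]
    simp only [Finset.sum_comm (t := Finset.univ.erase (w (i + 1)))]
    refine Finset.sum_le_sum fun m' hm' => ?_
    simp only [← Finset.mul_sum]
    refine sum_codebookWeight_mul_pass_le hp0 hp hκ hκ1 w
      (Function.update (Function.update w i m) (i + 1) m') ∅ {i, i + 1} (fun l => ?_) (hΓ 2)
    by_cases hl : l = i + 1
    · subst hl
      simpa [eq_comm] using hm'
    · by_cases hl' : l = i
      · subst hl'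
        rw [Function.update_of_ne hl, Function.update_self]
        simpa [eq_comm] using hm
      · simp [hl, hl']

end Receiver

end InfoTheory

/-! ### Existence of a good code and large deviations -/

namespace InfoTheory

theorem exists_le_of_sum_mul_le {ι : Type*} [Fintype ι] {w f : ι → ℝ} (hw : ∀ i, 0 ≤ w i)
    (hw1 : ∑ i, w i = 1) {B : ℝ} (h : ∑ i, w i * f i ≤ B) : ∃ i, f i ≤ B := by
  by_contra! hne
  have h0 : ∀ i ∈ Finset.univ, 0 ≤ w i * (f i - B) := fun i _ =>
    mul_nonneg (hw i) (sub_nonneg.2 (hne i).le)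
  have h1 : ∑ i, w i * (f i - B) ≤ 0 := by
    simp only [mul_sub, Finset.sum_sub_distrib, ← Finset.sum_mul, hw1]
    linarith
  have h2 := (Finset.sum_eq_zero_iff_of_nonneg h0).1 (le_antisymm h1 (Finset.sum_nonneg h0))
  have h3 : ∀ i, w i = 0 := fun i =>
    (mul_eq_zero.1 (h2 i (Finset.mem_univ i))).resolve_right (sub_pos.2 (hne i)).ne'
  simp [h3] at hw1

open Classical in
/-- Random coding: some code is as good as the average over the time-sharing sequence and the
random codebooks. -/
theorem exists_code {Q O : Type*} [Fintype Q] [Fintype O] {α D : Fin 3 → Type*}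
    [∀ i, Fintype (α i)] [∀ i, Fintype (D i)] {P : Q → ℝ} (hP : P ∈ stdSimplex ℝ Q)
    {p : Q → ∀ i, α i → ℝ} (hp : ∀ q i, p q i ∈ stdSimplex ℝ (α i)) {K : (∀ i, α i) → O → ℝ}
    (hK : ∀ x, K x ∈ stdSimplex ℝ O) (o : ∀ i, O → D i) {M : Fin 3 → ℕ} (hM : ∀ i, 0 < M i)
    {Γ : Fin 3 → Fin 3 → ℝ} (hΓ : ∀ i j, 0 < Γ i j) :
    ∃ (C : ∀ i, Fin (M i) → α i) (dec : ∀ i, D i → Fin (M i)),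
      (∏ i, (M i : ℝ))⁻¹ * ∑ w : ∀ i, Fin (M i), ∑ y,
        (if ∃ i, dec i (o i y) ≠ w i then K (fun i => C i (w i)) y else 0) ≤
      ∑ i, (∑ q, P q * ∑ x, (∏ l, p q l (x l)) * ∑ y, K x y *
          (if ¬ PassesTests (p q) (fun x => law (K x) (o i)) (Γ i) i x (o i y) then 1 else 0)
        + (M (i + 2) - 1) * (Γ i 0)⁻¹ + (M i - 1) * (Γ i 1)⁻¹
        + (M i - 1) * ((M (i + 1) - 1) * (Γ i 2)⁻¹)) := by
  let κ : ∀ i, (∀ i, α i) → D i → ℝ := fun i x => law (K x) (o i)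
  -- Any triple that passes may be chosen, since only its `i`-th entry is kept and uniqueness is
  -- required of that entry alone. The default message is irrelevant: if nothing passes, the true
  -- triple fails too.
  let dec : Q → (∀ i, Fin (M i) → α i) → ∀ i, D i → Fin (M i) := fun q C i d =>
    if h : ∃ w' : ∀ i, Fin (M i), PassesTests (p q) (κ i) (Γ i) i (fun l => C l (w' l)) d
    then h.choose i else ⟨0, hM i⟩
  let bad : Q → (∀ i, Fin (M i) → α i) → ∀ i, (∀ i, Fin (M i)) → D i → ℝ := fun q C i w d =>
    if ¬ PassesTests (p q) (κ i) (Γ i) i (fun l => C l (w l)) d ∨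
        ∃ w' : ∀ i, Fin (M i), PassesTests (p q) (κ i) (Γ i) i (fun l => C l (w' l)) d ∧ w' i ≠ w i
      then 1 else 0
  have hbad0 : ∀ q C i w d, 0 ≤ bad q C i w d := fun q C i w d => by
    simp only [bad]; split_ifs <;> norm_num
  have hdec : ∀ q C i w d, dec q C i d ≠ w i → bad q C i w d = 1 := by
    intro q C i w d h
    refine if_pos ?_
    by_cases hex : ∃ w' : ∀ i, Fin (M i), PassesTests (p q) (κ i) (Γ i) i (fun l => C l (w' l)) d
    · right
      refine ⟨hex.choose, hex.choose_spec, ?_⟩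
      simpa only [dec, dif_pos hex] using h
    · left
      exact fun h' => hex ⟨w, h'⟩
  have hM' : ∏ i, (M i : ℝ) ≠ 0 := Finset.prod_ne_zero_iff.2 fun i _ => Nat.cast_ne_zero.2 (hM i).ne'
  have herr : ∀ q C, (∏ i, (M i : ℝ))⁻¹ * ∑ w : ∀ i, Fin (M i), ∑ y,
      (if ∃ i, dec q C i (o i y) ≠ w i then K (fun i => C i (w i)) y else 0) ≤
      (∏ i, (M i : ℝ))⁻¹ * ∑ w : ∀ i, Fin (M i), ∑ i,
        ∑ d, κ i (fun l => C l (w l)) d * bad q C i w d := by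
    intro q C
    refine mul_le_mul_of_nonneg_left (Finset.sum_le_sum fun w _ => ?_) (by positivity)
    have e : ∀ i, ∑ d, κ i (fun l => C l (w l)) d * bad q C i w d
        = ∑ y, K (fun l => C l (w l)) y * bad q C i w (o i y) := fun i => sum_law_mul _ _ _
    simp only [e]
    rw [Finset.sum_comm]
    refine Finset.sum_le_sum fun y _ => ?_
    rw [← Finset.mul_sum]
    split_ifs with h
    · obtain ⟨i, hi⟩ := h
      refine le_mul_of_one_le_right ((hK _).1 y) ?_
      rw [← hdec q C i w _ hi]
      exact Finset.single_le_sum (f := fun i => bad q C i w (o i y)) (fun i _ => hbad0 _ _ _ _ _)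
        (Finset.mem_univ i)
    · exact mul_nonneg ((hK _).1 y) (Finset.sum_nonneg fun i _ => hbad0 _ _ _ _ _)
  set Bq : Q → Fin 3 → ℝ := fun q i => ∑ x, (∏ l, p q l (x l)) * ∑ y, K x y *
          (if ¬ PassesTests (p q) (fun x => law (K x) (o i)) (Γ i) i x (o i y) then 1 else 0)
    with hBq
  set B' : Fin 3 → ℝ := fun i => (M (i + 2) - 1) * (Γ i 0)⁻¹ + (M i - 1) * (Γ i 1)⁻¹
        + (M i - 1) * ((M (i + 1) - 1) * (Γ i 2)⁻¹) with hB'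
  have hrec : ∀ q i w, ∑ C, codebookWeight (p q) C *
      ∑ d, κ i (fun l => C l (w l)) d * bad q C i w d ≤ Bq q i + B' i := by
    intro q i w
    have := sum_codebookWeight_mul_error_le (p := p q) (κ := κ i) (fun i => (hp q i).1)
      (fun i => (hp q i).2) (fun x => law_nonneg (hK x).1 _)
      (fun x => (sum_law _ _).trans (hK x).2) (hΓ i) i w
    refine this.trans (le_of_eq ?_)
    have e : ∀ x, ∑ d, κ i x d * (if ¬ PassesTests (p q) (κ i) (Γ i) i x d then (1 : ℝ) else 0)
        = ∑ y, K x y * (if ¬ PassesTests (p q) (κ i) (Γ i) i x (o i y) then (1 : ℝ) else 0) :=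
      fun x => sum_law_mul _ _ fun d =>
        (if ¬ PassesTests (p q) (κ i) (Γ i) i x d then (1 : ℝ) else 0)
    simp only [e]
    simp only [hBq, hB', κ]
    ring
  have havg : ∀ q, ∑ C, codebookWeight (p q) C * ((∏ i, (M i : ℝ))⁻¹ * ∑ w : ∀ i, Fin (M i), ∑ i,
        ∑ d, κ i (fun l => C l (w l)) d * bad q C i w d) ≤ ∑ i, (Bq q i + B' i) := by
    intro q
    have e : ∑ C, codebookWeight (p q) C * ((∏ i, (M i : ℝ))⁻¹ * ∑ w : ∀ i, Fin (M i), ∑ i,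
        ∑ d, κ i (fun l => C l (w l)) d * bad q C i w d) = (∏ i, (M i : ℝ))⁻¹ *
        ∑ w : ∀ i, Fin (M i), ∑ i, ∑ C, codebookWeight (p q) C *
          ∑ d, κ i (fun l => C l (w l)) d * bad q C i w d := by
      have e' : ∀ (r : ℝ) (G : (∀ i, Fin (M i) → α i) → (∀ i, Fin (M i)) → Fin 3 → ℝ),
          ∑ C, codebookWeight (p q) C * (r * ∑ w, ∑ i, G C w i)
            = r * ∑ w, ∑ i, ∑ C, codebookWeight (p q) C * G C w i := by
        intro r G
        simp only [Finset.mul_sum]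
        rw [Finset.sum_comm]
        refine Finset.sum_congr rfl fun w _ => ?_
        rw [Finset.sum_comm]
        simp only [mul_left_comm r]
      exact e' _ fun C w i => ∑ d, κ i (fun l => C l (w l)) d * bad q C i w d
    rw [e, inv_mul_le_iff₀ (by positivity)]
    calc _ ≤ ∑ w : ∀ i, Fin (M i), ∑ i, (Bq q i + B' i) :=
          Finset.sum_le_sum fun w _ => Finset.sum_le_sum fun i _ => hrec q i w
      _ = _ := by simp
  -- Time-sharing sequence and codebook are fixed together, with the sum of the three receivers'
  -- error bounds as the averaged quantity; separate choices would not serve all receivers.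
  obtain ⟨⟨q, C⟩, hqC⟩ := exists_le_of_sum_mul_le
    (w := fun s : Q × (∀ i, Fin (M i) → α i) => P s.1 * codebookWeight (p s.1) s.2)
    (f := fun s => (∏ i, (M i : ℝ))⁻¹ * ∑ w : ∀ i, Fin (M i), ∑ i,
        ∑ d, κ i (fun l => s.2 l (w l)) d * bad s.1 s.2 i w d)
    (B := ∑ i, (∑ q, P q * Bq q i + B' i))
    (fun s => mul_nonneg (hP.1 _) (codebookWeight_nonneg (fun i => (hp _ i).1) _))
    (by
      simp only [Fintype.sum_prod_type, ← Finset.mul_sum,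
        fun q => sum_codebookWeight (M := M) fun i => (hp q i).2, mul_one, hP.2])
    (by
      simp only [Fintype.sum_prod_type, mul_assoc, ← Finset.mul_sum]
      refine (Finset.sum_le_sum fun q _ => mul_le_mul_of_nonneg_left (havg q) (hP.1 q)).trans ?_
      simp only [Finset.mul_sum]
      rw [Finset.sum_comm]
      refine Finset.sum_le_sum fun i _ => ?_
      simp only [mul_add, Finset.sum_add_distrib]
      rw [← Finset.sum_mul, hP.2, one_mul])
  refine ⟨C, dec q C, (herr q C).trans (hqC.trans (le_of_eq ?_))⟩
  simp only [hBq, hB', add_assoc]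

/-- Exponential form of the weak law of large numbers: the lower tail of a sum of independent
copies of `f`. -/
theorem exists_lower_tail_le {Ω : Type*} [Fintype Ω] {μ : Ω → ℝ} (hμ : ∀ ω, 0 ≤ μ ω)
    (h1 : ∑ ω, μ ω = 1) (f : Ω → ℝ) {θ : ℝ} (hθ : θ < ∑ ω, μ ω * f ω) :
    ∃ ρ : ℝ, 0 ≤ ρ ∧ ρ < 1 ∧ ∀ n : ℕ, ∀ s : Set (Fin n → Ω),
      (∀ ω ∈ s, (∀ t, μ (ω t) ≠ 0) → ∑ t, f (ω t) ≤ n * θ) →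
      ∑ ω, s.indicator (fun ω => ∏ t, μ (ω t)) ω ≤ ρ ^ n := by
  -- Chernoff's bound: `φ 0 = 1` and the derivative at `0` is negative, so some `r > 0` has `φ r <
  -- 1`.
  let φ : ℝ → ℝ := fun r => ∑ ω, μ ω * Real.exp (r * (θ - f ω))
  have hφ0 : φ 0 = 1 := by simp [φ, h1]
  have hd : HasDerivAt φ (∑ ω, μ ω * (θ - f ω)) 0 := by
    refine HasDerivAt.fun_sum fun ω _ => ?_
    have := (((hasDerivAt_id (0 : ℝ)).mul_const (θ - f ω)).exp).const_mul (μ ω)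
    simpa using this
  have hneg : ∑ ω, μ ω * (θ - f ω) < 0 := by
    simp only [mul_sub, Finset.sum_sub_distrib, ← Finset.sum_mul, h1]
    linarith
  obtain ⟨r, hr0, hr⟩ : ∃ r > 0, φ r < 1 := by
    have h2 := (hd.tendsto_slope_zero_right).eventually_lt_const hneg
    obtain ⟨r, hr, hr0⟩ := (h2.and self_mem_nhdsWithin).exists
    have hr0' : (0 : ℝ) < r := hr0
    refine ⟨r, hr0', ?_⟩
    rw [zero_add, hφ0, smul_eq_mul, inv_mul_eq_div, div_neg_iff] at hr
    rcases hr with hr | hr <;> linarith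
  refine ⟨φ r, Finset.sum_nonneg fun ω _ => mul_nonneg (hμ ω) (Real.exp_pos _).le, hr,
    fun n s hs => ?_⟩
  have e : φ r ^ n = ∑ ω : Fin n → Ω, ∏ t, μ (ω t) * Real.exp (r * (θ - f (ω t))) := by
    rw [← Fintype.prod_sum fun (_ : Fin n) ω => μ ω * Real.exp (r * (θ - f ω))]
    simp [φ]
  rw [e]
  refine Finset.sum_le_sum fun ω _ => ?_
  by_cases hω : ω ∈ s
  · rw [Set.indicator_of_mem hω, Finset.prod_mul_distrib, ← Real.exp_sum]
    by_cases h0 : ∀ t, μ (ω t) ≠ 0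
    · refine le_mul_of_one_le_right (Finset.prod_nonneg fun _ _ => hμ _) (Real.one_le_exp ?_)
      rw [← Finset.mul_sum]
      refine mul_nonneg hr0.le ?_
      rw [Finset.sum_sub_distrib, Finset.sum_const, Finset.card_fin, nsmul_eq_mul]
      linarith [hs ω hω h0]
    -- Off the support the product weight vanishes, so the hypothesis on `s` is needed only on the
    -- support, where the logarithms in `infoDensity` are genuine.
    · push Not at h0
      obtain ⟨t, ht⟩ := h0
      rw [Finset.prod_eq_zero (Finset.mem_univ t) ht, zero_mul]
  · rw [Set.indicator_of_notMem hω]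
    exact Finset.prod_nonneg fun _ _ => mul_nonneg (hμ _) (Real.exp_pos _).le

/-- Averaging respects the product over time, so the logarithm of a block likelihood ratio is a sum
over channel uses. -/
theorem avgKernel_prod {ι : Type*} [Fintype ι] [DecidableEq ι] {α : ι → Type*}
    [∀ i, Fintype (α i)] {D : Type*} {n : ℕ} (p : Fin n → ∀ i, α i → ℝ)
    (κ : (∀ i, α i) → D → ℝ) (S : Finset ι) (x : ∀ i, Fin n → α i) (d : Fin n → D) :
    avgKernel (fun i a => ∏ t, p t i (a t)) (fun (x : ∀ i, Fin n → α i) d => ∏ t, κ (fun i => x i t) (d t)) S x d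
      = ∏ t, avgKernel (p t) κ S (fun i => x i t) (d t) := by
  simp only [avgKernel]
  rw [Fintype.prod_sum, ← (Equiv.piComm fun (_ : Fin n) i => α i).sum_comp]
  refine Finset.sum_congr rfl fun z _ => ?_
  rw [Finset.prod_comm, ← Finset.prod_mul_distrib]
  refine Finset.prod_congr rfl fun t _ => ?_
  congr 2
  ext i
  by_cases h : i ∈ S <;> simp [h]

end InfoTheory

/-! ### Information densities and their means -/

namespace DMIC

variable {X Y : Fin 3 → Type*} [∀ i, Fintype (X i)] [∀ i, Fintype (Y i)]

/-- The marginal channel to receiver `i`. -/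
noncomputable def kernel (W : DMIC X Y) (i : Fin 3) (x : ∀ i, X i) (d : Y i) : ℝ :=
  law (W.trans x) (fun y => y i) d

-- The averaged kernel is the conditional law of the output given the inputs outside `S`, because
-- the inputs are independent. The map `e` is any encoding of those inputs.
open Classical in
theorem law_jointLaw_output (W : DMIC X Y) {p : ∀ i, X i → ℝ}
    (hp : ∀ i, p i ∈ stdSimplex ℝ (X i)) (i : Fin 3) (S : Finset (Fin 3)) {E : Type*}
    (e : (∀ i, X i) → E) (he : ∀ x x', e x = e x' ↔ ∀ l ∉ S, x l = x' l) (x₀ : ∀ i, X i) (d : Y i) :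
    law (W.jointLaw p) (fun z => (z.2 i, e z.1)) (d, e x₀)
      = law (W.jointLaw p) (fun z => e z.1) (e x₀) * avgKernel p (W.kernel i) S x₀ d := by
  have h1 : law (W.jointLaw p) (fun z => (z.2 i, e z.1)) (d, e x₀)
      = ∑ x, (∏ l, p l (x l)) * (if e x = e x₀ then W.kernel i x d else 0) := by
    simp only [law, Fintype.sum_prod_type, kernel, jointLaw, Prod.mk.injEq]
    refine Finset.sum_congr rfl fun x _ => ?_
    by_cases h : e x = e x₀
    · simp [h, Finset.mul_sum]
    · simp [h]
  have h2 : law (W.jointLaw p) (fun z => e z.1) (e x₀)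
      = ∑ x, (∏ l, p l (x l)) * (if e x = e x₀ then 1 else 0) := by
    simp only [law, Fintype.sum_prod_type, jointLaw]
    refine Finset.sum_congr rfl fun x _ => ?_
    by_cases h : e x = e x₀
    · simp only [h, if_true, ← Finset.mul_sum, (W.trans_mem x).2]
    · simp [h]
  rw [h1, h2, sum_prod_mul_piecewise (fun i => (hp i).2) S, Finset.sum_mul]
  refine Finset.sum_congr rfl fun x _ => ?_
  have h3 : ∀ z, e (S.piecewise z x) = e x := fun z => (he _ _).2 fun l hl => by simp [hl]
  simp only [h3, mul_assoc]
  congr 1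
  by_cases h : e x = e x₀
  · simp only [h, if_true, one_mul]
    exact avgKernel_congr ((he x x₀).1 h) d
  · simp [h]

/-- The average includes the term at the actual input, which is positive on the support; this
licenses the logarithms. -/
theorem avgKernel_kernel_pos (W : DMIC X Y) {p : ∀ i, X i → ℝ}
    (hp : ∀ i, p i ∈ stdSimplex ℝ (X i)) (i : Fin 3) (S : Finset (Fin 3))
    {z : (∀ i, X i) × (∀ i, Y i)} (hz : W.jointLaw p z ≠ 0) :
    0 < avgKernel p (W.kernel i) S z.1 (z.2 i) := by
  have h1 : 0 ≤ W.kernel i z.1 (z.2 i) := law_nonneg (W.trans_mem _).1 _ _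
  have h2 : W.trans z.1 z.2 ≤ W.kernel i z.1 (z.2 i) := le_law (W.trans_mem _).1 (fun y => y i) z.2
  have h3 := lt_of_le_of_ne (W.jointLaw_nonneg hp z) hz.symm
  have h4 : W.jointLaw p z ≤ (∏ l, p l (z.1 l)) * W.kernel i z.1 (z.2 i) :=
    mul_le_mul_of_nonneg_left h2 (Finset.prod_nonneg fun l _ => (hp l).1 _)
  refine lt_of_lt_of_le (lt_of_lt_of_le h3 h4) ?_
  have := Finset.single_le_sum (f := fun x => (∏ l, p l (x l)) *
    W.kernel i (S.piecewise x z.1) (z.2 i)) (fun x _ => mul_nonneg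
      (Finset.prod_nonneg fun l _ => (hp l).1 _) (law_nonneg (W.trans_mem _).1 _ _))
    (Finset.mem_univ z.1)
  have e : S.piecewise z.1 z.1 = z.1 := by
    ext l
    by_cases h : l ∈ S <;> simp [h]
  simpa [avgKernel, e] using this

theorem sum_jointLaw_mul_logb_avgKernel (W : DMIC X Y) {p : ∀ i, X i → ℝ}
    (hp : ∀ i, p i ∈ stdSimplex ℝ (X i)) (i : Fin 3) (S : Finset (Fin 3)) {E : Type*}
    (e : (∀ i, X i) → E) (he : ∀ x x', e x = e x' ↔ ∀ l ∉ S, x l = x' l) :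
    ∑ z, W.jointLaw p z * Real.logb 2 (avgKernel p (W.kernel i) S z.1 (z.2 i))
      = entropy (W.jointLaw p) (fun z => e z.1)
        - entropy (W.jointLaw p) (fun z => (z.2 i, e z.1)) := by
  simp only [entropy, W.law_jointLaw_output hp i S e he]
  rw [← neg_add_eq_sub, neg_neg, ← sub_eq_add_neg, ← Finset.sum_sub_distrib]
  refine Finset.sum_congr rfl fun z _ => ?_
  by_cases hz : W.jointLaw p z = 0
  · simp [hz]
  rw [Real.logb_mul (law_pos (W.jointLaw_nonneg hp) (fun z => e z.1) hz).ne'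
    (W.avgKernel_kernel_pos hp i S hz).ne']
  ring

end DMIC

namespace DMIC

variable {X Y : Fin 3 → Type*} [∀ i, Fintype (X i)] [∀ i, Fintype (Y i)]

/-- The users treated as noise in the numerators of the three tests of receiver `i`. -/
def numeratorNoise (i : Fin 3) : Fin 3 → Finset (Fin 3) := ![{i, i + 1}, ∅, ∅]

/-- The users treated as noise in the denominators of the three tests of receiver `i`. -/
def denominatorNoise (i : Fin 3) : Fin 3 → Finset (Fin 3) :=
  ![{i, i + 1} ∪ {i + 2}, ∅ ∪ {i}, ∅ ∪ {i, i + 1}]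

theorem passesTests_iff {α : Fin 3 → Type*} [∀ i, Fintype (α i)] {D : Type*}
    {p : ∀ i, α i → ℝ} {κ : (∀ i, α i) → D → ℝ} {Γ : Fin 3 → ℝ} {i : Fin 3} {x : ∀ i, α i} {d : D} :
    PassesTests p κ Γ i x d ↔ ∀ j, Γ j * avgKernel p κ (denominatorNoise i j) x d
      < avgKernel p κ (numeratorNoise i j) x d := by
  simp [PassesTests, Fin.forall_fin_succ, numeratorNoise, denominatorNoise]

/-- The information density that the `j`-th test of receiver `i` compares with its threshold. -/
noncomputable def infoDensity (W : DMIC X Y) (p : ∀ i, X i → ℝ) (i j : Fin 3)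
    (z : (∀ i, X i) × (∀ i, Y i)) : ℝ :=
  Real.logb 2 (avgKernel p (W.kernel i) (numeratorNoise i j) z.1 (z.2 i))
    - Real.logb 2 (avgKernel p (W.kernel i) (denominatorNoise i j) z.1 (z.2 i))

/-- Each logarithm averages to minus the entropy of the output given the inputs not treated as
noise, so the means are differences of conditional entropies. They are the limits against which `R
(i + 2)`, `R i` and `R i + R (i + 1)` are compared. -/
theorem sum_jointLaw_mul_infoDensity (W : DMIC X Y) {p : ∀ i, X i → ℝ}
    (hp : ∀ i, p i ∈ stdSimplex ℝ (X i)) (i j : Fin 3) :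
    ∑ z, W.jointLaw p z * W.infoDensity p i j z =
      ![mutualInfo (W.jointLaw p) (fun z => z.1 (i + 2)) (fun z => z.2 i),
        (W.rateBound p i).1, (W.rateBound p i).2] j := by
  have hμ := W.jointLaw_nonneg hp
  have hμ1 := W.sum_jointLaw hp
  have d1 := i.add_one_ne_self_of_three
  have d2 := i.add_two_ne_self_of_three
  have d3 : i + 2 ≠ i + 1 := by clear * -; decide +revert
  have h3 := i.eq_or_eq_add_one_or_eq_add_two
  have s0 := W.sum_jointLaw_mul_logb_avgKernel hp i ({i, i + 1} ∪ {i + 2}) (fun _ => ())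
    (fun x x' => by
      simp only [Finset.mem_union, Finset.mem_insert, Finset.mem_singleton, true_iff]
      intro l hl
      have := h3 l
      tauto)
  have s1 := W.sum_jointLaw_mul_logb_avgKernel hp i {i, i + 1} (fun x => x (i + 2))
    (fun x x' => by
      simp only [Finset.mem_insert, Finset.mem_singleton]
      refine ⟨fun h l hl => ?_, fun h => h _ (by tauto)⟩
      obtain rfl : l = i + 2 := by have := h3 l; tauto
      exact h)
  have s2 := W.sum_jointLaw_mul_logb_avgKernel hp i {i} (fun x => (x (i + 1), x (i + 2)))
    (fun x x' => by
      simp only [Finset.mem_singleton, Prod.mk.injEq]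
      refine ⟨fun h l hl => ?_, fun h => ⟨h _ d1, h _ d2⟩⟩
      rcases (h3 l).resolve_left hl with rfl | rfl
      exacts [h.1, h.2])
  have s3 := W.sum_jointLaw_mul_logb_avgKernel hp i ∅ (fun x => x) (fun x x' => by simp [funext_iff])
  simp only [infoDensity, mul_sub, Finset.sum_sub_distrib]
  fin_cases j
  · simp only [numeratorNoise, denominatorNoise, Fin.zero_eta, Matrix.cons_val_zero]
    rw [s0, s1, mutualInfo_eq_condMutualInfo hμ1, condMutualInfo_eq_entropy hμ, entropy_const hμ1,
      entropy_congr (W.jointLaw p) (A := fun z => (z.1 (i + 2), z.2 i, ()))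
        (B := fun z => (z.2 i, z.1 (i + 2))) (by intro z z'; simp only [Prod.mk.injEq]; tauto),
      entropy_congr (W.jointLaw p) (A := fun z => (z.1 (i + 2), ()))
        (B := fun z => z.1 (i + 2)) (by intro z z'; simp only [Prod.mk.injEq]; tauto)]
    ring
  · simp only [numeratorNoise, denominatorNoise, Fin.mk_one, Matrix.cons_val_one,
      Matrix.cons_val_zero, Finset.empty_union]
    rw [s2, s3, rateBound, condMutualInfo_eq_entropy hμ,
      entropy_congr (W.jointLaw p) (A := fun z => (z.1 i, z.1 (i + 1), z.1 (i + 2)))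
        (B := fun z => z.1) (by intro z z'; rw [funext_fin_three_iff i]; simp only [Prod.mk.injEq]),
      entropy_congr (W.jointLaw p) (A := fun z => (z.1 i, z.2 i, z.1 (i + 1), z.1 (i + 2)))
        (B := fun z => (z.2 i, z.1)) (by
          intro z z'; simp only [Prod.mk.injEq]; rw [funext_fin_three_iff i z.1]; tauto)]
    ring
  · simp only [numeratorNoise, denominatorNoise, Fin.reduceFinMk, Matrix.cons_val,
      Finset.empty_union]
    rw [s1, s3]
    simp only [rateBound]
    rw [condMutualInfo_eq_entropy hμ,
      entropy_congr (W.jointLaw p) (A := fun z => ((z.1 i, z.1 (i + 1)), z.1 (i + 2)))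
        (B := fun z => z.1) (by
          intro z z'; rw [funext_fin_three_iff i]; simp only [Prod.mk.injEq]; tauto),
      entropy_congr (W.jointLaw p) (A := fun z => ((z.1 i, z.1 (i + 1)), z.2 i, z.1 (i + 2)))
        (B := fun z => (z.2 i, z.1)) (by
          intro z z'; simp only [Prod.mk.injEq]; rw [funext_fin_three_iff i z.1]; tauto)]
    ring

/-! ### Failure of the tests, and achievability -/

section Blocks

variable {Q : Type*} {n : ℕ}

theorem timeSharingLaw_nonneg (W : DMIC X Y) {pQ : Q → ℝ} {p : ∀ i, Q → X i → ℝ}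
    (hQ : ∀ q, 0 ≤ pQ q) (hp : ∀ i q, p i q ∈ stdSimplex ℝ (X i)) (ω) :
    0 ≤ W.timeSharingLaw pQ p ω := by
  rw [← Prod.mk.eta (p := ω), timeSharingLaw_eq]
  exact mul_nonneg (hQ _) (W.jointLaw_nonneg (fun i => hp i _) _)

theorem sum_timeSharingLaw_mul [Fintype Q] (W : DMIC X Y) (pQ : Q → ℝ) (p : ∀ i, Q → X i → ℝ)
    (f : Q × (∀ i, X i) × (∀ i, Y i) → ℝ) :
    ∑ ω, W.timeSharingLaw pQ p ω * f ω
      = ∑ q, pQ q * ∑ z, W.jointLaw (fun i => p i q) z * f (q, z) := by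
  rw [Fintype.sum_prod_type]
  simp only [timeSharingLaw_eq, Finset.mul_sum, mul_assoc]

/-- Interchange of time and user indices. -/
def blockEquiv (X Y : Fin 3 → Type*) (Q : Type*) (n : ℕ) :
    (Fin n → Q × (∀ i, X i) × (∀ i, Y i)) ≃
      (Fin n → Q) × (∀ i, Fin n → X i) × (Fin n → ∀ i, Y i) where
  toFun ω := (fun t => (ω t).1, fun i t => (ω t).2.1 i, fun t => (ω t).2.2)
  invFun s t := (s.1 t, fun i => s.2.1 i t, s.2.2 t)
  left_inv _ := rfl
  right_inv _ := rfl

open Classical in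
/-- The probability that the transmitted codewords fail a test decays exponentially. -/
theorem exists_fail_tests_le [Fintype Q] (W : DMIC X Y) {pQ : Q → ℝ} {p : ∀ i, Q → X i → ℝ}
    (hQ : pQ ∈ stdSimplex ℝ Q) (hp : ∀ i q, p i q ∈ stdSimplex ℝ (X i)) (i : Fin 3)
    {θ : Fin 3 → ℝ}
    (hθ : ∀ j, θ j < ∑ q, pQ q * ∑ z, W.jointLaw (fun i => p i q) z *
      W.infoDensity (fun i => p i q) i j z) :
    ∃ ρ : Fin 3 → ℝ, (∀ j, 0 ≤ ρ j ∧ ρ j < 1) ∧ ∀ n : ℕ,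
      ∑ q : Fin n → Q, (∏ t, pQ (q t)) * ∑ x : ∀ l, Fin n → X l, (∏ l, ∏ t, p l (q t) (x l t)) *
        ∑ y : Fin n → ∀ l, Y l, (∏ t, W.trans (fun l => x l t) (y t)) *
          (if ¬ PassesTests (fun l (a : Fin n → X l) => ∏ t, p l (q t) (a t))
            (fun x : ∀ l, Fin n → X l => law (fun y : Fin n → ∀ l, Y l =>
              ∏ t, W.trans (fun l => x l t) (y t)) (fun y t => y t i))
            (fun j => 2 ^ (n * θ j)) i x (fun t => y t i) then 1 else 0) ≤ ∑ j, ρ j ^ n := by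
  set μ := W.timeSharingLaw pQ p with hμ_def
  have hμ : ∀ ω, 0 ≤ μ ω := W.timeSharingLaw_nonneg hQ.1 hp
  have hμ1 : ∑ ω, μ ω = 1 := by
    have := W.sum_timeSharingLaw_mul pQ p fun _ => 1
    simpa [fun q => W.sum_jointLaw fun i => hp i q, hQ.2] using this
  have htail := fun j => exists_lower_tail_le hμ hμ1
    (fun ω => W.infoDensity (fun i => p i ω.1) i j ω.2) (θ := θ j)
    (by rw [hμ_def, W.sum_timeSharingLaw_mul]; exact hθ j)
  choose ρ hρ0 hρ1 hρ using htail
  refine ⟨ρ, fun j => ⟨hρ0 j, hρ1 j⟩, fun n => ?_⟩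
  let avg : Finset (Fin 3) → Q × (∀ i, X i) × (∀ i, Y i) → ℝ := fun S ω =>
    avgKernel (fun i => p i ω.1) (W.kernel i) S ω.2.1 (ω.2.2 i)
  have havg : ∀ S ω, μ ω ≠ 0 → 0 < avg S ω := fun S ω h => by
    rw [hμ_def, ← Prod.mk.eta (p := ω), timeSharingLaw_eq] at h
    exact W.avgKernel_kernel_pos (fun i => hp i ω.1) i S (right_ne_zero_of_mul h)
  -- The event that the `j`-th block test fails. On the support, taking logarithms turns it into a
  -- lower tail of a sum of densities.
  let s : Fin 3 → Set (Fin n → Q × (∀ i, X i) × (∀ i, Y i)) := fun j =>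
    {ω | ¬ (2 : ℝ) ^ (n * θ j) * ∏ t, avg (denominatorNoise i j) (ω t)
      < ∏ t, avg (numeratorNoise i j) (ω t)}
  have hs : ∀ j, ∀ ω ∈ s j, (∀ t, μ (ω t) ≠ 0) →
      ∑ t, W.infoDensity (fun i => p i (ω t).1) i j (ω t).2 ≤ n * θ j := by
    intro j ω hω h0
    have hd : 0 < ∏ t, avg (denominatorNoise i j) (ω t) :=
      Finset.prod_pos fun t _ => havg _ _ (h0 t)
    have hn : 0 < ∏ t, avg (numeratorNoise i j) (ω t) :=
      Finset.prod_pos fun t _ => havg _ _ (h0 t)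
    have h1 := Real.logb_le_logb_of_le (b := 2) (by norm_num) hn (not_lt.1 hω)
    rw [Real.logb_mul (by positivity) hd.ne', Real.logb_rpow (by norm_num) (by norm_num),
      Real.logb_prod _ _ fun t _ => (havg _ _ (h0 t)).ne',
      Real.logb_prod _ _ fun t _ => (havg _ _ (h0 t)).ne'] at h1
    simp only [infoDensity, Finset.sum_sub_distrib]
    linarith
  have hker : ∀ x : ∀ l, Fin n → X l, law (fun y : Fin n → ∀ l, Y l =>
      ∏ t, W.trans (fun l => x l t) (y t)) (fun y t => y t i)
      = fun d => ∏ t, W.kernel i (fun l => x l t) (d t) := fun x => funext fun d =>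
    law_pi (fun t => W.trans (fun l => x l t)) (fun _ y => y i) d
  have hpt : ∀ ω : Fin n → Q × (∀ i, X i) × (∀ i, Y i),
      (if ¬ PassesTests (fun l (a : Fin n → X l) => ∏ t, p l (ω t).1 (a t))
            (fun x : ∀ l, Fin n → X l => law (fun y : Fin n → ∀ l, Y l =>
              ∏ t, W.trans (fun l => x l t) (y t)) (fun y t => y t i))
            (fun j => 2 ^ (n * θ j)) i (fun l t => (ω t).2.1 l) (fun t => (ω t).2.2 i)
        then (1 : ℝ) else 0) ≤ ∑ j, (s j).indicator (fun _ => (1 : ℝ)) ω := by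
    intro ω
    have h0 : ∀ j ∈ Finset.univ, 0 ≤ (s j).indicator (fun _ => (1 : ℝ)) ω := fun j _ =>
      Set.indicator_nonneg (fun _ _ => zero_le_one) ω
    rw [passesTests_iff]
    split_ifs with h
    · exact Finset.sum_nonneg h0
    · push Not at h
      obtain ⟨j, hj⟩ := h
      have hmem : ω ∈ s j := by
        simp only [hker, avgKernel_prod (fun t l => p l (ω t).1) (W.kernel i)] at hj
        exact not_lt.2 hj
      refine le_trans ?_ (Finset.single_le_sum h0 (Finset.mem_univ j))
      rw [Set.indicator_of_mem hmem]
  simp only [Finset.mul_sum]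
  have hsum : ∀ G : (Fin n → Q) → (∀ l, Fin n → X l) → (Fin n → ∀ l, Y l) → ℝ,
      ∑ q, ∑ x, ∑ y, G q x y
        = ∑ ω : Fin n → Q × (∀ i, X i) × (∀ i, Y i), G (fun t => (ω t).1) (fun l t => (ω t).2.1 l) (fun t => (ω t).2.2) := by
    intro G
    rw [← (blockEquiv X Y Q n).symm.sum_comp]
    simp only [Fintype.sum_prod_type]
    rfl
  rw [hsum]
  calc _ ≤ ∑ ω : Fin n → Q × (∀ i, X i) × (∀ i, Y i), (∏ t, μ (ω t)) *
        ∑ j, (s j).indicator (fun _ => (1 : ℝ)) ω := by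
        refine Finset.sum_le_sum fun ω _ => ?_
        refine le_trans (le_of_eq ?_) (mul_le_mul_of_nonneg_left (hpt ω)
          (Finset.prod_nonneg fun t _ => hμ (ω t)))
        simp only [hμ_def, timeSharingLaw, Finset.prod_mul_distrib]
        rw [Finset.prod_comm]
        ring
    _ = ∑ j, ∑ ω, (s j).indicator (fun ω => ∏ t, μ (ω t)) ω := by
        simp only [Finset.mul_sum]
        rw [Finset.sum_comm]
        refine Finset.sum_congr rfl fun j _ => Finset.sum_congr rfl fun ω _ => ?_
        by_cases h : ω ∈ s j <;> simp [h]
    _ ≤ ∑ j, ρ j ^ n := Finset.sum_le_sum fun j _ => hρ j n (s j) (hs j)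

end Blocks

/-- Counts the wrong messages. For `r ≤ 0` there is a single message and none is wrong, so the bound
holds with `r` itself and negative rates need no separate case. -/
theorem natCeil_two_rpow_max_sub_one_le (n : ℕ) (r : ℝ) :
    (⌈(2 : ℝ) ^ ((n : ℝ) * max r 0)⌉₊ : ℝ) - 1 ≤ 2 ^ ((n : ℝ) * r) := by
  rcases le_total 0 r with h | h
  · rw [max_eq_left h]
    have := Nat.ceil_lt_add_one (a := (2 : ℝ) ^ ((n : ℝ) * r)) (by positivity)
    linarith
  · rw [max_eq_right h]
    simp
    positivity

/-- Rates strictly inside the bounds of a time-sharing law are achievable. -/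
theorem achievable_of_rateBounds (W : DMIC X Y) (hvs : W.CyclicVeryStrong) {Q : Type*} [Fintype Q]
    {pQ : Q → ℝ} {p : ∀ i, Q → X i → ℝ} (hQ : pQ ∈ stdSimplex ℝ Q)
    (hp : ∀ i q, p i q ∈ stdSimplex ℝ (X i)) {R : Fin 3 → ℝ}
    (hR : (fun i => (R i, R i + R (i + 1))) ≤ ∑ q, pQ q • W.rateBound (fun i => p i q)) {δ : ℝ}
    (hδ : 0 < δ) : W.Achievable fun i => max (R i - 2 * δ) 0 := by
  classical
  refine ⟨fun i => le_max_right _ _, ?_⟩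
  -- Thresholds lie `δ` below bounds for the mean densities and rates `2 * δ` below `R`, leaving a
  -- margin of at least `δ` both for the true codewords and against each family of wrong ones.
  let θ : Fin 3 → Fin 3 → ℝ := fun i => ![R (i + 2) - δ, R i - δ, R i + R (i + 1) - δ]
  have hR1 : ∀ i, R i ≤ ∑ q, pQ q * (W.rateBound (fun i => p i q) i).1 := fun i => by
    simpa [Finset.sum_apply, Prod.fst_sum] using (hR i).1
  have hR2 : ∀ i, R i + R (i + 1) ≤ ∑ q, pQ q * (W.rateBound (fun i => p i q) i).2 := fun i => by
    simpa [Finset.sum_apply, Prod.snd_sum] using (hR i).2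
  have hθ : ∀ i j, θ i j < ∑ q, pQ q * ∑ z, W.jointLaw (fun i => p i q) z *
      W.infoDensity (fun i => p i q) i j z := by
    intro i j
    simp only [fun q => W.sum_jointLaw_mul_infoDensity (fun i => hp i q)]
    fin_cases j
    -- The only use of very strong interference: user `i + 2` is heard at receiver `i`, since `i + 2
    -- + 1 = i`, well enough to be decoded first.
    · have h : R (i + 2) ≤ ∑ q, pQ q * mutualInfo (W.jointLaw fun i => p i q)
          (fun z => z.1 (i + 2)) (fun z => z.2 i) := by
        refine (hR1 (i + 2)).trans (Finset.sum_le_sum fun q _ =>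
          mul_le_mul_of_nonneg_left ?_ (hQ.1 q))
        have := hvs (fun i => p i q) (fun i => hp i q) (i + 2)
        have e : i + 2 + 1 = i := by clear * -; decide +revert
        rw [e] at this
        rwa [rateBound, e]
      simpa [θ] using lt_of_lt_of_le (sub_lt_self _ hδ) h
    · simpa [θ] using lt_of_lt_of_le (sub_lt_self _ hδ) (hR1 i)
    · simpa [θ] using lt_of_lt_of_le (sub_lt_self _ hδ) (hR2 i)
  choose ρ hρ hfail using fun i => W.exists_fail_tests_le hQ hp i (hθ i)
  have hM : ∀ (n : ℕ) i, 0 < ⌈(2 : ℝ) ^ ((n : ℝ) * max (R i - 2 * δ) 0)⌉₊ :=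
    fun n i => Nat.ceil_pos.2 (by positivity)
  have hcode : ∀ n : ℕ, ∃ c : DMICCode X Y n fun i => ⌈(2 : ℝ) ^ ((n : ℝ) * max (R i - 2 * δ) 0)⌉₊,
      W.errorProb c ≤ ∑ i, (∑ j, ρ i j ^ n + 3 * (2 ^ (-δ) : ℝ) ^ n) := by
    intro n
    have hpow : ∀ {ι : Type _} [Fintype ι] {f : ι → ℝ}, f ∈ stdSimplex ℝ ι →
        (fun a : Fin n → ι => ∏ t, f (a t)) ∈ stdSimplex ℝ (Fin n → ι) := fun {ι} _ {f} hf =>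
      ⟨fun a => Finset.prod_nonneg fun t _ => hf.1 _, by
        rw [← Fintype.prod_sum fun (_ : Fin n) a => f a]
        simp [hf.2]⟩
    obtain ⟨C, dec, h⟩ := exists_code (P := fun q : Fin n → Q => ∏ t, pQ (q t)) (hpow hQ)
      (p := fun q i (a : Fin n → X i) => ∏ t, p i (q t) (a t))
      (fun q i => ⟨fun a => Finset.prod_nonneg fun t _ => (hp i _).1 _, by
        rw [← Fintype.prod_sum fun (t : Fin n) a => p i (q t) a]
        simp [fun q => (hp i q).2]⟩)
      (K := fun (x : ∀ l, Fin n → X l) (y : Fin n → ∀ l, Y l) =>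
        ∏ t, W.trans (fun l => x l t) (y t))
      (fun x => ⟨fun y => Finset.prod_nonneg fun t _ => (W.trans_mem _).1 _, by
        rw [← Fintype.prod_sum fun (t : Fin n) y => W.trans (fun l => x l t) y]
        simp [fun x => (W.trans_mem x).2]⟩)
      (fun i y t => y t i) (hM n) (Γ := fun i j => 2 ^ (n * θ i j)) (fun i j => by positivity)
    refine ⟨⟨C, dec⟩, le_trans (le_of_eq ?_) (h.trans (Finset.sum_le_sum fun i _ => ?_))⟩
    · rw [errorProb]
    · have hfl := hfail i n
      have hc := fun i => natCeil_two_rpow_max_sub_one_le n (R i - 2 * δ)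
      have hc0 : ∀ i, (0 : ℝ) ≤ (⌈(2 : ℝ) ^ ((n : ℝ) * max (R i - 2 * δ) 0)⌉₊ : ℝ) - 1 := fun i =>
        sub_nonneg.2 (by exact_mod_cast hM n i)
      have hn0 : (0 : ℝ) ≤ n := Nat.cast_nonneg n
      have e : (2 ^ (-δ) : ℝ) ^ n = 2 ^ (-δ * n) := by
        rw [Real.rpow_mul (by norm_num), Real.rpow_natCast]
      have hinv : ∀ r : ℝ, ((2 : ℝ) ^ (n * r))⁻¹ = 2 ^ (-(n * r)) := fun r => by
        rw [Real.rpow_neg (by norm_num)]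
      have t0 : ((⌈(2 : ℝ) ^ ((n : ℝ) * max (R (i + 2) - 2 * δ) 0)⌉₊ : ℝ) - 1)
          * ((2 : ℝ) ^ (n * θ i 0))⁻¹ ≤ (2 ^ (-δ) : ℝ) ^ n := by
        refine (mul_le_mul_of_nonneg_right (hc _) (by positivity)).trans ?_
        rw [hinv, ← Real.rpow_add (by norm_num), e]
        refine Real.rpow_le_rpow_of_exponent_le (by norm_num) (le_of_eq ?_)
        simp only [θ, Matrix.cons_val_zero]
        ring
      have t1 : ((⌈(2 : ℝ) ^ ((n : ℝ) * max (R i - 2 * δ) 0)⌉₊ : ℝ) - 1)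
          * ((2 : ℝ) ^ (n * θ i 1))⁻¹ ≤ (2 ^ (-δ) : ℝ) ^ n := by
        refine (mul_le_mul_of_nonneg_right (hc _) (by positivity)).trans ?_
        rw [hinv, ← Real.rpow_add (by norm_num), e]
        refine Real.rpow_le_rpow_of_exponent_le (by norm_num) (le_of_eq ?_)
        simp only [θ, Matrix.cons_val_one, Matrix.cons_val_zero]
        ring
      have t2 : ((⌈(2 : ℝ) ^ ((n : ℝ) * max (R i - 2 * δ) 0)⌉₊ : ℝ) - 1)
          * (((⌈(2 : ℝ) ^ ((n : ℝ) * max (R (i + 1) - 2 * δ) 0)⌉₊ : ℝ) - 1)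
          * ((2 : ℝ) ^ (n * θ i 2))⁻¹) ≤ (2 ^ (-δ) : ℝ) ^ n := by
        refine (mul_le_mul (hc _) (mul_le_mul_of_nonneg_right (hc _) (by positivity))
          (mul_nonneg (hc0 _) (by positivity)) (by positivity)).trans ?_
        rw [hinv, ← Real.rpow_add (by norm_num), ← Real.rpow_add (by norm_num), e]
        -- Two rates are reduced by `2 * δ` each against one threshold reduced by `δ`, so the
        -- exponent is `-3 * δ * n`.
        refine Real.rpow_le_rpow_of_exponent_le (by norm_num) ?_
        simp only [θ, Matrix.cons_val]
        nlinarith [mul_nonneg hn0 hδ.le]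
      linarith
  choose c hc using hcode
  refine ⟨c, ?_⟩
  have hlim : Filter.Tendsto (fun n : ℕ => ∑ i, (∑ j, ρ i j ^ n + 3 * (2 ^ (-δ) : ℝ) ^ n))
      Filter.atTop (𝓝 0) := by
    have h2 : Filter.Tendsto (fun n : ℕ => 3 * ((2 : ℝ) ^ (-δ)) ^ n) Filter.atTop (𝓝 0) := by
      simpa using (tendsto_pow_atTop_nhds_zero_of_lt_one (by positivity)
        (Real.rpow_lt_one_of_one_lt_of_neg (by norm_num) (neg_lt_zero.2 hδ))).const_mul (3 : ℝ)
    have h1 : ∀ i, Filter.Tendsto (fun n : ℕ => ∑ j, ρ i j ^ n + 3 * ((2 : ℝ) ^ (-δ)) ^ n)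
        Filter.atTop (𝓝 0) := fun i => by
      simpa using (tendsto_finsetSum Finset.univ fun j _ =>
        tendsto_pow_atTop_nhds_zero_of_lt_one (hρ i j).1 (hρ i j).2).add h2
    simpa using tendsto_finsetSum Finset.univ fun i _ => h1 i
  refine squeeze_zero (fun n => ?_) hc hlim
  rw [errorProb_eq]
  exact Finset.sum_nonneg fun z _ => by split_ifs <;> simp [codeLaw_nonneg]

end DMIC

/-! ### The capacity region -/

theorem theorem1 {X Y : Fin 3 → Type*} [∀ i, Fintype (X i)] [∀ i, Fintype (Y i)]
    (W : DMIC X Y) (hvs : W.CyclicVeryStrong) (hs : W.CyclicStrong) :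
    W.capacityRegion =
      {R : Fin 3 → ℝ | ∃ m : ℕ, m ≤ 7 ∧ ∃ pQ : Fin m → ℝ, ∃ p : ∀ i, Fin m → X i → ℝ,
        pQ ∈ stdSimplex ℝ (Fin m) ∧ (∀ i q, p i q ∈ stdSimplex ℝ (X i)) ∧
        DMIC.RateBounds (W.timeSharingLaw pQ p) R} := by
  refine Set.Subset.antisymm ?_ ?_
  · rw [DMIC.setOf_rateBounds_eq]
    have hclosed : IsClosed ({R : Fin 3 → ℝ | 0 ≤ R} ∩ (fun R i => (R i, R i + R (i + 1))) ⁻¹'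
        {u | ∃ v ∈ W.rateBoundHull, u ≤ v}) :=
      isClosed_Ici.inter (W.isClosed_lowerClosure_rateBoundHull.preimage (by fun_prop))
    exact closure_minimal (fun R hR => ⟨hR.1, hR.exists_mem_rateBoundHull W hs⟩) hclosed
  · rintro R ⟨m, -, pQ, p, hQ, hp, hR⟩
    obtain ⟨h0, hR⟩ := (W.rateBounds_timeSharingLaw_iff hQ hp R).1 hR
    -- A point of the region is a limit of achievable triples, the truncation at `0` disappearing in
    -- the limit because `R` is nonnegative.
    have hlim : Filter.Tendsto (fun (δ : ℝ) (i : Fin 3) => max (R i - 2 * δ) 0) (𝓝[>] 0) (𝓝 R) := by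
      refine tendsto_nhdsWithin_of_tendsto_nhds (tendsto_pi_nhds.2 fun i => ?_)
      have : Continuous fun δ : ℝ => max (R i - 2 * δ) 0 := by fun_prop
      simpa [h0 i] using this.tendsto 0
    exact mem_closure_of_tendsto hlim (Filter.eventually_of_mem self_mem_nhdsWithin
      fun δ hδ => W.achievable_of_rateBounds hvs hQ hp hR hδ)
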